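/- Notation. Let $N\in\mathbb N$ and $T>0$; $|\cdot|$ and $\langle\cdot,\cdot\rangle$ are the Euclidean norm and inner product. For an extended real-valued function $\varphi$, let $\operatorname{dom}\varphi=\{z:\varphi(z)\neq\pm\infty\}$ and $\operatorname{epi}\varphi=\{(z,r): r\in\mathbb R,\ \varphi(z)\le r\}$; $\varphi$ is proper if it never takes the value $-\infty$ and is not identically $+\infty$. For $E\subset\mathbb R^M$ and $w\in E$ let $$T_E(w)=\Big\{\zeta\in\mathbb R^M:\ \liminf_{\tau\to0+}\frac{\operatorname{dist}(w+\tau\zeta,E)}{\tau}=0\Big\},\qquad N_E(w)=\{\xi\in\mathbb R^M:\ \langle\zeta,\xi\rangle\le0\ \text{ for all }\zeta\in T_E(w)\}.$$ Let $L:[0,T]\times\mathbb R^N\times\mathbb R^N\to[-\infty,+\infty]$ satisfy: (L1) $L$ is lower semicontinuous in all variables jointly; (L2) for all $(t,x)\in[0,T]\times\mathbb R^N$ the function $L(t,x,\cdot)$ is convex and proper; (L3) for every $(t,x,v)\in[0,T]\times\mathbb R^N\times\mathbb R^N$ and every sequence $(t_n,x_n)\to(t,x)$ in $[0,T]\times\mathbb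 R^N$ there are $v_n\to v$ with $L(t_n,x_n,v_n)\to L(t,x,v)$; (L4) for every $R\ge0$ there is $C_R\ge0$ such that $L(t,x,v)=+\infty$ whenever $t\in[0,T]$, $|x|\le R$ and $|v|>C_R$; (L5) there are an integrable $c:[0,T]\to[0,+\infty)$ and a Lebesgue null set $\mathcal N$ such that $L(t,x,v)=+\infty$ whenever $t\in[0,T]\setminus\mathcal N$ and $|v|>c(t)(1+|x|)$. For $(t,x)\in[0,T]\times\mathbb R^N$ put $Q(t,x)=\{(v,\eta)\in\mathbb R^N\times\mathbb R:\ L(t,x,v)\le-\eta\}$. Theorem (Viability Theorem). Let $L$ satisfy (L1)–(L5), and let $U:[0,T]\times\mathbb R^N\to\mathbb R\cup\{+\infty\}$ be proper, lower semicontinuous, and such that the following condition holds, where $\operatorname{epi}U\subset[0,T]\times\mathbb R^N\times\mathbb R$ is regarded as a subset of $\mathbb R^{1+N+1}$: for every $(t,x)\in\operatorname{dom}U$ with $t<T$ and every $(n^t,n^x,n^u)\in N_{\operatorname{epi}U}(t,x,U(t,x))$ there exist sequences $(t_k,x_k)\to(t,x)$ in $[0,T]\times\mathbb R^N$, $\alpha_k\to0$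 in $\mathbb R$, and $v_k\in\operatorname{dom}L(t_k,x_k,\cdot)$ such that $$n^t+\langle v_k,n^x\rangle-n^u\,L(t_k,x_k,v_k)\le\alpha_k\qquad\text{for all }k\in\mathbb N.$$ Then for every $(t_0,x_0)\in\operatorname{dom}U$ with $t_0<T$ there exists an absolutely continuous function $(x,u):[t_0,T]\to\mathbb R^N\times\mathbb R$ with $(x,u)(t_0)=(x_0,U(t_0,x_0))$ such that $(\dot x(t),\dot u(t))\in Q(t,x(t))$ for almost every $t\in[t_0,T]$ and $u(t)\ge U(t,x(t))$ for all $t\in[t_0,T]$. -/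

import Mathlib

open Set Filter MeasureTheory
open scoped Topology

namespace Viability

/-- The space of triples `(t, x, u)` with `t, u` real and `x` in `ℝ^N`, with its Euclidean norm and
inner product. The coordinates of `w` are `w.fst`, `w.snd.fst` and `w.snd.snd`. -/
abbrev Triple (N : ℕ) : Type :=
  WithLp 2 (ℝ × WithLp 2 (EuclideanSpace ℝ (Fin N) × ℝ))

/-- The triple `(t, x, u)`. -/
def mkTriple {N : ℕ} (t : ℝ) (x : EuclideanSpace ℝ (Fin N)) (u : ℝ) : Triple N :=
  WithLp.toLp 2 (t, WithLp.toLp 2 (x, u))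

/-- The effective domain of an extended real-valued function. -/
def effDom {α : Type*} (f : α → EReal) : Set α :=
  {z | f z ≠ ⊤ ∧ f z ≠ ⊥}

/-- The tangent (contingent) cone: all `ζ` with `liminf_{τ → 0+} dist (w + τ ζ, E) / τ = 0`.
For `w ∈ E` the quotient lies between `0` and `‖ζ‖`, so the real `liminf` is the true one. -/
def tangentCone {F : Type*} [NormedAddCommGroup F] [InnerProductSpace ℝ F]
    (E : Set F) (w : F) : Set F :=
  {ζ | liminf (fun τ : ℝ => Metric.infDist (w + τ • ζ) E / τ) (𝓝[>] (0 : ℝ)) = 0}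

/-- The normal cone, the polar of the tangent cone. -/
def normalCone {F : Type*} [NormedAddCommGroup F] [InnerProductSpace ℝ F]
    (E : Set F) (w : F) : Set F :=
  {ξ | ∀ ζ ∈ tangentCone E w, inner ℝ ζ ξ ≤ 0}

/-- The epigraph of a function `U` on `[0,T] × ℝ^N`; only values at times in `[0,T]` matter. -/
def epi {N : ℕ} (T : ℝ) (U : ℝ → EuclideanSpace ℝ (Fin N) → EReal) : Set (Triple N) :=
  {w | w.fst ∈ Icc 0 T ∧ U w.fst w.snd.fst ≤ (w.snd.snd : EReal)}

/-- `U`, as a function on `[0,T] × ℝ^N`, is proper: it never takes the value `-∞` and is not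
identically `+∞`. -/
def IsProper {N : ℕ} (T : ℝ) (U : ℝ → EuclideanSpace ℝ (Fin N) → EReal) : Prop :=
  (∀ t ∈ Icc 0 T, ∀ x, U t x ≠ ⊥) ∧ ∃ t ∈ Icc 0 T, ∃ x, U t x ≠ ⊤

/-- The assumptions on a Lagrangian `L : [0,T] × ℝ^N × ℝ^N → [-∞,+∞]`; only values at times in
`[0,T]` matter. -/
structure IsLagrangian {N : ℕ} (T : ℝ)
    (L : ℝ → EuclideanSpace ℝ (Fin N) → EuclideanSpace ℝ (Fin N) → EReal) : Prop where
  /-- `L` is lower semicontinuous in all variables jointly. -/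
  lsc : LowerSemicontinuousOn
    (fun p : ℝ × EuclideanSpace ℝ (Fin N) × EuclideanSpace ℝ (Fin N) => L p.1 p.2.1 p.2.2)
    (Icc 0 T ×ˢ univ)
  /-- `L(t,x,·)` is convex, that is, has a convex epigraph. -/
  convex : ∀ t ∈ Icc 0 T, ∀ x,
    Convex ℝ {p : EuclideanSpace ℝ (Fin N) × ℝ | L t x p.1 ≤ (p.2 : EReal)}
  /-- `L(t,x,·)` is proper. -/
  proper : ∀ t ∈ Icc 0 T, ∀ x, (∀ v, L t x v ≠ ⊥) ∧ ∃ v, L t x v ≠ ⊤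
  /-- Each value of `L` is recovered along every sequence of base points, for suitable `v_n`. -/
  recovery : ∀ t ∈ Icc 0 T, ∀ x v, ∀ (s : ℕ → ℝ) (y : ℕ → EuclideanSpace ℝ (Fin N)),
    (∀ n, s n ∈ Icc 0 T) → Tendsto s atTop (𝓝 t) → Tendsto y atTop (𝓝 x) →
    ∃ w : ℕ → EuclideanSpace ℝ (Fin N), Tendsto w atTop (𝓝 v) ∧
      Tendsto (fun n => L (s n) (y n) (w n)) atTop (𝓝 (L t x v))
  /-- The effective domains are bounded, uniformly for `x` in a ball. -/
  bounded : ∀ R : ℝ, 0 ≤ R → ∃ C : ℝ, 0 ≤ C ∧ ∀ t ∈ Icc 0 T, ∀ x v,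
    ‖x‖ ≤ R → C < ‖v‖ → L t x v = ⊤
  /-- The effective domains have at most linear growth, with an integrable factor `c`. -/
  growth : ∃ c : ℝ → ℝ, (∀ t ∈ Icc 0 T, 0 ≤ c t) ∧ IntegrableOn c (Icc 0 T) ∧
    ∃ Z : Set ℝ, volume Z = 0 ∧ ∀ t ∈ Icc 0 T \ Z, ∀ x v,
      c t * (1 + ‖x‖) < ‖v‖ → L t x v = ⊤

/-- The set-valued map `Q(t,x) = {(v,η) | (v,-η) ∈ epi L(t,x,·)}`. -/
def Q {N : ℕ} (L : ℝ → EuclideanSpace ℝ (Fin N) → EuclideanSpace ℝ (Fin N) → EReal)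
    (t : ℝ) (x : EuclideanSpace ℝ (Fin N)) : Set (EuclideanSpace ℝ (Fin N) × ℝ) :=
  {p | L t x p.1 ≤ ((-p.2 : ℝ) : EReal)}

/-- The approximate boundary condition on normals to the epigraph of `U`. The real number
`(L (s k) (y k) (v k)).toReal` is the value of `L`, which is finite as `v k` is in the effective
domain. -/
def BoundaryCondition {N : ℕ} (T : ℝ)
    (L : ℝ → EuclideanSpace ℝ (Fin N) → EuclideanSpace ℝ (Fin N) → EReal)
    (U : ℝ → EuclideanSpace ℝ (Fin N) → EReal) : Prop :=
  ∀ t ∈ Ico 0 T, ∀ x ∈ effDom (U t),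
    ∀ n ∈ normalCone (epi T U) (mkTriple t x (U t x).toReal),
      ∃ (s : ℕ → ℝ) (y v : ℕ → EuclideanSpace ℝ (Fin N)) (α : ℕ → ℝ),
        (∀ k, s k ∈ Icc 0 T) ∧ Tendsto s atTop (𝓝 t) ∧ Tendsto y atTop (𝓝 x) ∧
        Tendsto α atTop (𝓝 0) ∧
        ∀ k, v k ∈ effDom (L (s k) (y k)) ∧
          n.fst + inner ℝ (v k) n.snd.fst - n.snd.snd * (L (s k) (y k) (v k)).toReal ≤ α k

end Viability

/-!
The proof follows Euler polygons in the space of triples `(t, x, u)` that aim at the epigraph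
of `U`.

*Polygons.* If `s` is a nearest point of `epi U` to `w`, then `w - s` is a normal to `epi U`, also
when it is based at the point of the graph below `s`
(`sub_mem_normalCone_of_nearest`). The boundary condition then gives velocities `(1, v, -ℓ)` with
`⟪(1, v, -ℓ), w - s⟫ ≤ ε`, where `ℓ` is a value `L(t,y,v)` near `s`. Since the vertical
component of `w - s` is nonpositive, `ℓ` may be replaced by its truncation at any level `m`
(`BoundaryCondition.exists_velocity`). The velocities are then bounded, and a step in such a
direction increases the squared distance to `epi U` only by the small amount
`h (2 ε + h B ^ 2)`. Hence, if the step `h` is chosen after `m`, the polygon stays as close to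
`epi U` as desired (`exists_euler_polygon`). Polygons rest when they leave a large ball or come
near the final time.

*Limit.* Let `m → ∞` and the other parameters tend to `0`. The polygons are bounded, the states are
equi-Lipschitz, and the slopes of the vertical components are bounded above, since `L` is bounded
below on bounded sets. The pointwise limit along an ultrafilter is a curve in `epi U` with Lipschitz
state `x` and a vertical component that is a decreasing function plus a linear one
(`exists_isLimitCurve`). Both are differentiable almost everywhere. Lower semicontinuity
of `L` and the local boundedness of its domains make the Hamiltonian
`H(t,x,p) = sup_v (⟪v, p⟫ - L(t,x,v))` upper semicontinuous in `(t,x)`, so difference quotients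
of the limit curve satisfy `⟪x', p⟫ + u' ≤ H(t,x,p)` for all `p`, which by convexity means
`(x', u') ∈ Q(t,x)` (`IsLimitCurve.le_of_hasDerivAt`). Gronwall's inequality and the growth
condition show that the limit never leaves the ball (`log_one_add_norm_sq_le`).

*Absolute continuity.* The vertical component may have downward jumps and a decreasing singular
part. The integral of its derivative omits these, so it lies above the vertical component, hence
above `U(t,x(t))`, and it is the desired function `u`.
-/

namespace Viability

/-! ### Nearest points and normals -/

/-- If `s + a` is a point of `E` nearest to `w` and `E` is stable under translation by `a`, then
`w - (s + a)` is normal to `E` at `s`. With `a = 0` this says that proximal normals are normals; a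
vertical `a` moves the base point of a normal to an epigraph down to the graph. -/
lemma sub_mem_normalCone_of_nearest {F : Type*} [NormedAddCommGroup F] [InnerProductSpace ℝ F]
    {E : Set F} {w s a : F} (hs : s ∈ E) (ha : ∀ e ∈ E, e + a ∈ E)
    (hmin : ∀ e ∈ E, ‖w - (s + a)‖ ≤ ‖w - e‖) : w - (s + a) ∈ normalCone E s := by
  intro ζ hζ
  set ξ := w - (s + a) with hξ
  by_contra! hc
  set c := inner ℝ ζ ξ with hcdef
  set ε := c / (2 * (‖ξ‖ + 1)) with hε
  have hε0 : 0 < ε := by positivity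
  have hεξ : 2 * ε * ‖ξ‖ ≤ c := by
    rw [hε]
    have : 2 * (c / (2 * (‖ξ‖ + 1))) * ‖ξ‖ = c * (‖ξ‖ / (‖ξ‖ + 1)) := by field_simp
    rw [this]
    have : ‖ξ‖ / (‖ξ‖ + 1) ≤ 1 := by
      rw [div_le_one (by positivity)]; linarith
    nlinarith
  have hbdd : ∀ᶠ τ in 𝓝[>] (0 : ℝ), Metric.infDist (s + τ • ζ) E / τ ≤ ‖ζ‖ := by
    filter_upwards [self_mem_nhdsWithin] with τ hτ
    have hτ : 0 < τ := hτ
    rw [div_le_iff₀ hτ]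
    refine (Metric.infDist_le_dist_of_mem hs).trans ?_
    rw [dist_eq_norm, add_sub_cancel_left, norm_smul, Real.norm_of_nonneg hτ.le, mul_comm]
  have hfreq : ∃ᶠ τ in 𝓝[>] (0 : ℝ), Metric.infDist (s + τ • ζ) E / τ < ε := by
    have hlim : liminf (fun τ : ℝ => Metric.infDist (s + τ • ζ) E / τ) (𝓝[>] (0 : ℝ)) = 0 := hζ
    refine frequently_lt_of_liminf_lt ?_ (by rw [hlim]; exact hε0)
    exact (isBoundedUnder_of_eventually_le hbdd).isCoboundedUnder_ge
  have hsmall : ∀ᶠ τ in 𝓝[>] (0 : ℝ), τ * (‖ζ‖ + ε) ^ 2 < c := by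
    have : Tendsto (fun τ : ℝ => τ * (‖ζ‖ + ε) ^ 2) (𝓝[>] (0 : ℝ)) (𝓝 0) := by
      have h : Tendsto (fun τ : ℝ => τ * (‖ζ‖ + ε) ^ 2) (𝓝 0) (𝓝 (0 * (‖ζ‖ + ε) ^ 2)) :=
        (continuous_id.mul continuous_const).tendsto 0
      rw [zero_mul] at h
      exact h.mono_left nhdsWithin_le_nhds
    exact this.eventually (gt_mem_nhds hc)
  obtain ⟨τ, hτε, hτc, hτ⟩ := (hfreq.and_eventually (hsmall.and self_mem_nhdsWithin)).exists
  have hτ : 0 < τ := hτ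
  rw [div_lt_iff₀ hτ, Metric.infDist_lt_iff ⟨s, hs⟩] at hτε
  obtain ⟨e, he, hde⟩ := hτε
  set b := τ⁻¹ • (e - (s + τ • ζ)) with hb
  have hbe : e = s + τ • ζ + τ • b := by
    rw [hb, smul_inv_smul₀ hτ.ne']; abel
  have hbn : ‖b‖ ≤ ε := by
    rw [hb, norm_smul, norm_inv, Real.norm_of_nonneg hτ.le, ← dist_eq_norm, dist_comm,
      inv_mul_le_iff₀ hτ, mul_comm]
    exact hde.le
  have h1 := hmin _ (ha e he)
  have h2 : w - (e + a) = ξ - τ • (ζ + b) := by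
    rw [hbe, hξ, smul_add]; abel
  rw [h2] at h1
  have h3 : ‖ξ‖ ^ 2 ≤ ‖ξ - τ • (ζ + b)‖ ^ 2 := by gcongr
  rw [norm_sub_sq_real ξ, inner_smul_right, norm_smul, Real.norm_of_nonneg hτ.le, mul_pow,
    inner_add_right, real_inner_comm ζ ξ, ← hcdef] at h3
  have h4 : 2 * (c + inner ℝ ξ b) ≤ τ * ‖ζ + b‖ ^ 2 := by
    have : 0 ≤ τ * (τ * ‖ζ + b‖ ^ 2 - 2 * (c + inner ℝ ξ b)) := by nlinarith
    have := nonneg_of_mul_nonneg_right this hτ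
    linarith
  have h5 : -(‖ξ‖ * ε) ≤ inner ℝ ξ b := by
    have := abs_real_inner_le_norm ξ b
    have h6 := neg_abs_le (inner ℝ ξ b)
    have : ‖ξ‖ * ‖b‖ ≤ ‖ξ‖ * ε := by gcongr
    linarith
  have h7 : τ * ‖ζ + b‖ ^ 2 ≤ τ * (‖ζ‖ + ε) ^ 2 := by
    have : ‖ζ + b‖ ≤ ‖ζ‖ + ε := (norm_add_le _ _).trans (by linarith)
    gcongr
  nlinarith

/-! ### The space of triples -/

section Triple

variable {N : ℕ}

@[simp] lemma mkTriple_fst (t : ℝ) (x : EuclideanSpace ℝ (Fin N)) (u : ℝ) :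
    (mkTriple t x u).fst = t := rfl

@[simp] lemma mkTriple_snd_fst (t : ℝ) (x : EuclideanSpace ℝ (Fin N)) (u : ℝ) :
    (mkTriple t x u).snd.fst = x := rfl

@[simp] lemma mkTriple_snd_snd (t : ℝ) (x : EuclideanSpace ℝ (Fin N)) (u : ℝ) :
    (mkTriple t x u).snd.snd = u := rfl

lemma mkTriple_eta (w : Triple N) : mkTriple w.fst w.snd.fst w.snd.snd = w := rfl

lemma inner_mkTriple (t : ℝ) (x : EuclideanSpace ℝ (Fin N)) (u : ℝ) (w : Triple N) :
    inner ℝ (mkTriple t x u) w = t * w.fst + (inner ℝ x w.snd.fst + u * w.snd.snd) := by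
  rw [WithLp.prod_inner_apply, WithLp.prod_inner_apply]
  change w.fst * t + (inner ℝ x w.snd.fst + w.snd.snd * u) = _
  ring

lemma Triple.norm_sq (w : Triple N) :
    ‖w‖ ^ 2 = w.fst ^ 2 + (‖w.snd.fst‖ ^ 2 + w.snd.snd ^ 2) := by
  rw [WithLp.prod_norm_sq_eq_of_L2, WithLp.prod_norm_sq_eq_of_L2, Real.norm_eq_abs,
    Real.norm_eq_abs, sq_abs, sq_abs]

lemma Triple.abs_fst_le (w : Triple N) : |w.fst| ≤ ‖w‖ := by
  apply abs_le_of_sq_le_sq _ (norm_nonneg w)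
  nlinarith [Triple.norm_sq w, sq_nonneg ‖w.snd.fst‖, sq_nonneg w.snd.snd]

lemma Triple.norm_snd_fst_le (w : Triple N) : ‖w.snd.fst‖ ≤ ‖w‖ := by
  apply le_of_sq_le_sq _ (norm_nonneg w)
  nlinarith [Triple.norm_sq w, sq_nonneg w.fst, sq_nonneg w.snd.snd]

lemma Triple.abs_snd_snd_le (w : Triple N) : |w.snd.snd| ≤ ‖w‖ := by
  apply abs_le_of_sq_le_sq _ (norm_nonneg w)
  nlinarith [Triple.norm_sq w, sq_nonneg ‖w.snd.fst‖, sq_nonneg w.fst]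

lemma Triple.norm_le (w : Triple N) : ‖w‖ ≤ |w.fst| + ‖w.snd.fst‖ + |w.snd.snd| := by
  apply le_of_sq_le_sq _ (by positivity)
  rw [Triple.norm_sq, ← sq_abs w.fst, ← sq_abs w.snd.snd]
  nlinarith [mul_nonneg (abs_nonneg w.fst) (norm_nonneg w.snd.fst),
    mul_nonneg (abs_nonneg w.fst) (abs_nonneg w.snd.snd),
    mul_nonneg (norm_nonneg w.snd.fst) (abs_nonneg w.snd.snd)]

lemma Triple.continuous_fst : Continuous fun w : Triple N => w.fst := by fun_prop

lemma Triple.continuous_snd_fst : Continuous fun w : Triple N => w.snd.fst := by fun_prop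

lemma Triple.continuous_snd_snd : Continuous fun w : Triple N => w.snd.snd := by fun_prop

/-! ### Epigraphs -/

variable {T : ℝ} {U : ℝ → EuclideanSpace ℝ (Fin N) → EReal}

lemma isClosed_epi (hU : LowerSemicontinuousOn
    (fun p : ℝ × EuclideanSpace ℝ (Fin N) => U p.1 p.2) (Icc 0 T ×ˢ univ)) :
    IsClosed (epi T U) := by
  rw [lowerSemicontinuousOn_iff_isClosed_epigraph (isClosed_Icc.prod isClosed_univ)] at hU
  have hcont : Continuous fun w : Triple N =>
      (((w.fst, w.snd.fst), (w.snd.snd : EReal)) : (ℝ × EuclideanSpace ℝ (Fin N)) × EReal) :=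
    (Triple.continuous_fst.prodMk Triple.continuous_snd_fst).prodMk
      (continuous_coe_real_ereal.comp Triple.continuous_snd_snd)
  convert! hU.preimage hcont using 1
  ext w
  simp [epi]

lemma add_mkTriple_mem_epi {w : Triple N} (hw : w ∈ epi T U) {ρ : ℝ} (hρ : 0 ≤ ρ) :
    w + mkTriple 0 0 ρ ∈ epi T U := by
  refine ⟨?_, ?_⟩
  · change w.fst + 0 ∈ Icc 0 T
    rw [add_zero]; exact hw.1
  · change U (w.fst + 0) (w.snd.fst + 0) ≤ ((w.snd.snd + ρ : ℝ) : EReal)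
    rw [add_zero, add_zero]
    exact hw.2.trans (EReal.coe_le_coe_iff.mpr (by linarith))

/-- By compactness, `U` is bounded below on bounded sets of states. -/
lemma exists_lower_bound_of_isProper (hU : LowerSemicontinuousOn
    (fun p : ℝ × EuclideanSpace ℝ (Fin N) => U p.1 p.2) (Icc 0 T ×ˢ univ))
    (hp : IsProper T U) (R : ℝ) :
    ∃ K : ℝ, ∀ w ∈ epi T U, ‖w.snd.fst‖ ≤ R → -K ≤ w.snd.snd := by
  have hcomp : IsCompact (Icc 0 T ×ˢ Metric.closedBall (0 : EuclideanSpace ℝ (Fin N)) R) :=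
    isCompact_Icc.prod (isCompact_closedBall _ _)
  rcases (Icc 0 T ×ˢ Metric.closedBall (0 : EuclideanSpace ℝ (Fin N)) R).eq_empty_or_nonempty
    with h | h
  · refine ⟨0, fun w hw hR => ?_⟩
    have : (w.fst, w.snd.fst) ∈
        Icc 0 T ×ˢ Metric.closedBall (0 : EuclideanSpace ℝ (Fin N)) R :=
      ⟨hw.1, by simpa using hR⟩
    rw [h] at this
    exact this.elim
  · obtain ⟨a, ha, hmin⟩ := (hU.mono (prod_mono_right (subset_univ _))).exists_isMinOn h hcomp
    obtain ⟨k, -, hk⟩ := EReal.lt_iff_exists_real_btwn.mp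
      (bot_lt_iff_ne_bot.mpr (hp.1 a.1 ha.1 a.2))
    refine ⟨-k, fun w hw hR => ?_⟩
    have h1 : U a.1 a.2 ≤ U w.fst w.snd.fst :=
      hmin (show (w.fst, w.snd.fst) ∈ _ from ⟨hw.1, by simpa using hR⟩)
    rw [neg_neg]
    exact EReal.coe_le_coe_iff.mp (hk.le.trans (h1.trans hw.2))

/-- The vertical component of a vector pointing from a nearest point of an epigraph is
nonpositive. -/
lemma snd_snd_sub_nonpos_of_nearest {w s : Triple N} (hs : s ∈ epi T U)
    (hmin : ∀ e ∈ epi T U, ‖w - s‖ ≤ ‖w - e‖) : (w - s).snd.snd ≤ 0 := by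
  refine le_of_forall_pos_le_add fun ρ hρ => ?_
  have h := hmin _ (add_mkTriple_mem_epi hs hρ.le)
  have h2 : ‖w - s‖ ^ 2 ≤ ‖w - (s + mkTriple 0 0 ρ)‖ ^ 2 := by gcongr
  rw [← sub_sub, norm_sub_sq_real (w - s), ← real_inner_comm, inner_mkTriple,
    Triple.norm_sq (mkTriple _ _ _)] at h2
  simp only [mkTriple_fst, mkTriple_snd_fst, mkTriple_snd_snd, inner_zero_left, norm_zero] at h2
  have : 0 ≤ ρ * (ρ - 2 * (w - s).snd.snd) := by nlinarith
  have := nonneg_of_mul_nonneg_right this hρ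
  linarith

/-! ### The Lagrangian -/

variable {L : ℝ → EuclideanSpace ℝ (Fin N) → EuclideanSpace ℝ (Fin N) → EReal}

/-- The sets `{(t,x,v,η) | L(t,x,v) ≤ η}` are closed, in terms of limits along a filter. -/
lemma IsLagrangian.le_of_tendsto (hL : IsLagrangian T L) {ι : Type*} {l : Filter ι} [l.NeBot]
    {s : ι → ℝ} {y v : ι → EuclideanSpace ℝ (Fin N)} {η : ι → ℝ}
    {t r : ℝ} {x z : EuclideanSpace ℝ (Fin N)} (hs : Tendsto s l (𝓝 t)) (hy : Tendsto y l (𝓝 x))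
    (hv : Tendsto v l (𝓝 z)) (hη : Tendsto η l (𝓝 r)) (hmem : ∀ i, s i ∈ Icc 0 T)
    (hle : ∀ i, L (s i) (y i) (v i) ≤ (η i : EReal)) : L t x z ≤ (r : EReal) := by
  have h := (lowerSemicontinuousOn_iff_isClosed_epigraph
    (isClosed_Icc.prod isClosed_univ)).mp hL.lsc
  have h2 := h.mem_of_tendsto ((hs.prodMk_nhds (hy.prodMk_nhds hv)).prodMk_nhds
    ((continuous_coe_real_ereal.tendsto r).comp hη))
    (Eventually.of_forall fun i => ⟨⟨hmem i, mem_univ _⟩, hle i⟩)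
  exact h2.2

lemma coe_toReal_of_mem_effDom {α : Type*} {f : α → EReal} {z : α} (h : z ∈ effDom f) :
    ((f z).toReal : EReal) = f z := EReal.coe_toReal h.1 h.2

/-- On bounded sets of states, the effective domains are bounded and the Lagrangian is bounded
below. -/
lemma IsLagrangian.exists_bounds (hL : IsLagrangian T L) (R : ℝ) :
    ∃ C K : ℝ, 0 ≤ C ∧ 0 ≤ K ∧ ∀ t ∈ Icc 0 T, ∀ x, ‖x‖ ≤ R → ∀ v ∈ effDom (L t x),
      ‖v‖ ≤ C ∧ -K ≤ (L t x v).toReal := by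
  obtain ⟨C, hC, hCb⟩ := hL.bounded (max R 0) (le_max_right _ _)
  have hdom : ∀ t ∈ Icc 0 T, ∀ x, ‖x‖ ≤ R → ∀ v ∈ effDom (L t x), ‖v‖ ≤ C := by
    intro t ht x hx v hv
    by_contra! h
    exact hv.1 (hCb t ht x v (hx.trans (le_max_left _ _)) h)
  set S : Set (ℝ × EuclideanSpace ℝ (Fin N) × EuclideanSpace ℝ (Fin N)) :=
    Icc 0 T ×ˢ Metric.closedBall 0 R ×ˢ Metric.closedBall 0 C with hS
  have hcomp : IsCompact S :=
    isCompact_Icc.prod ((isCompact_closedBall _ _).prod (isCompact_closedBall _ _))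
  have hmemS : ∀ t ∈ Icc 0 T, ∀ x, ‖x‖ ≤ R → ∀ v ∈ effDom (L t x), (t, x, v) ∈ S :=
    fun t ht x hx v hv => ⟨ht, by simpa using hx, by simpa using hdom t ht x hx v hv⟩
  rcases S.eq_empty_or_nonempty with h | h
  · refine ⟨C, 0, hC, le_rfl, fun t ht x hx v hv => ?_⟩
    have := hmemS t ht x hx v hv
    rw [h] at this
    exact this.elim
  · obtain ⟨a, ha, hmin⟩ :=
      (hL.lsc.mono (prod_mono_right (subset_univ _))).exists_isMinOn h hcomp
    obtain ⟨k, -, hk⟩ := EReal.lt_iff_exists_real_btwn.mp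
      (bot_lt_iff_ne_bot.mpr ((hL.proper a.1 ha.1 a.2.1).1 a.2.2))
    refine ⟨C, |k|, hC, abs_nonneg k, fun t ht x hx v hv => ⟨hdom t ht x hx v hv, ?_⟩⟩
    have h1 : L a.1 a.2.1 a.2.2 ≤ L t x v := hmin (hmemS t ht x hx v hv)
    rw [← coe_toReal_of_mem_effDom hv] at h1
    exact (neg_abs_le k).trans (EReal.coe_le_coe_iff.mp (hk.le.trans h1))

/-- Upper semicontinuity in `(t,x)` of the Hamiltonian `sup_v (⟪v, p⟫ - L(t,x,v))`. -/
lemma IsLagrangian.exists_nhds_inner_sub_lt (hL : IsLagrangian T L) {t : ℝ}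
    {x p : EuclideanSpace ℝ (Fin N)} {β : ℝ}
    (hβ : ∀ v ∈ effDom (L t x), inner ℝ v p - (L t x v).toReal < β) :
    ∃ ρ > 0, ∀ s ∈ Icc 0 T, |s - t| < ρ → ∀ y, ‖y - x‖ < ρ → ∀ v ∈ effDom (L s y),
      inner ℝ v p - (L s y v).toReal < β := by
  by_contra! hcon
  choose s hs hst y hyx v hv hbad using fun k : ℕ => hcon (1 / ((k : ℝ) + 1)) (by positivity)
  have hs_lim : Tendsto s atTop (𝓝 t) :=
    tendsto_iff_dist_tendsto_zero.mpr (squeeze_zero (fun _ => dist_nonneg)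
      (fun k => (hst k).le) tendsto_one_div_add_atTop_nhds_zero_nat)
  have hy_lim : Tendsto y atTop (𝓝 x) :=
    tendsto_iff_norm_sub_tendsto_zero.mpr (squeeze_zero (fun _ => norm_nonneg _)
      (fun k => (hyx k).le) tendsto_one_div_add_atTop_nhds_zero_nat)
  have ht : t ∈ Icc 0 T := isClosed_Icc.mem_of_tendsto hs_lim (Eventually.of_forall hs)
  obtain ⟨C, K, -, -, hC⟩ := hL.exists_bounds (‖x‖ + 1)
  have hvC : ∀ k, v k ∈ Metric.closedBall (0 : EuclideanSpace ℝ (Fin N)) C := by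
    intro k
    have h1 : ‖y k‖ ≤ ‖x‖ + 1 := by
      have h2 : (1 : ℝ) / ((k : ℝ) + 1) ≤ 1 := by
        rw [div_le_one (by positivity)]; linarith [Nat.cast_nonneg (α := ℝ) k]
      have := norm_sub_norm_le (y k) x
      linarith [hyx k]
    simpa using (hC _ (hs k) _ h1 _ (hv k)).1
  obtain ⟨z, -, φ, hφ, hz⟩ := (isCompact_closedBall _ _).tendsto_subseq hvC
  have hle : L t x z ≤ ((inner ℝ z p - β : ℝ) : EReal) := by
    refine hL.le_of_tendsto (hs_lim.comp hφ.tendsto_atTop) (hy_lim.comp hφ.tendsto_atTop) hz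
      (η := fun k => inner ℝ (v (φ k)) p - β) ?_ (fun k => hs _) (fun k => ?_)
    · exact (hz.inner tendsto_const_nhds).sub_const β
    · simp only [Function.comp]
      rw [← coe_toReal_of_mem_effDom (hv (φ k)), EReal.coe_le_coe_iff]
      linarith [hbad (φ k)]
  have hzdom : z ∈ effDom (L t x) :=
    ⟨ne_top_of_le_ne_top (EReal.coe_ne_top _) hle, (hL.proper t ht x).1 z⟩
  have := hβ z hzdom
  rw [← coe_toReal_of_mem_effDom hzdom, EReal.coe_le_coe_iff] at hle
  linarith

/-- A point lies in the epigraph of `L(t,x,·)` if it satisfies all affine inequalities with finite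
slope that hold strictly on the epigraph. Vertical separating hyperplanes can be tilted, because the
effective domain of `L(t,x,·)` is bounded and so `L(t,x,·)` is bounded below. -/
lemma IsLagrangian.le_of_forall_inner_sub_le (hL : IsLagrangian T L) {t : ℝ} (ht : t ∈ Icc 0 T)
    {x z : EuclideanSpace ℝ (Fin N)} {r : ℝ}
    (h : ∀ (p : EuclideanSpace ℝ (Fin N)) (β : ℝ),
      (∀ v ∈ effDom (L t x), inner ℝ v p - (L t x v).toReal < β) → inner ℝ z p - r ≤ β) :
    L t x z ≤ (r : EReal) := by
  by_contra hzr
  set S := {q : EuclideanSpace ℝ (Fin N) × ℝ | L t x q.1 ≤ (q.2 : EReal)} with hS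
  have hclosed : IsClosed S := by
    refine isClosed_of_closure_subset fun q hq => ?_
    obtain ⟨f, hf, hlim⟩ := mem_closure_iff_seq_limit.mp hq
    exact hL.le_of_tendsto (tendsto_const_nhds (x := t)) (tendsto_const_nhds (x := x))
      ((continuous_fst.tendsto q).comp hlim) ((continuous_snd.tendsto q).comp hlim)
      (fun _ => ht) hf
  obtain ⟨f, α, hfS, hfz⟩ := geometric_hahn_banach_closed_point (hL.convex t ht x) hclosed
    (x := (z, r)) hzr
  set q := f (0, 1) with hq
  set p := (InnerProductSpace.toDual ℝ (EuclideanSpace ℝ (Fin N))).symm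
    (f.comp (ContinuousLinearMap.inl ℝ _ ℝ)) with hp
  have hf : ∀ v η, f (v, η) = inner ℝ v p + η * q := by
    intro v η
    have h1 : ((v, η) : EuclideanSpace ℝ (Fin N) × ℝ) = (v, 0) + η • (0, 1) := by simp
    rw [h1, map_add, map_smul, smul_eq_mul, real_inner_comm, hp,
      InnerProductSpace.toDual_symm_apply]
    rfl
  obtain ⟨C, K, -, hK0, hK⟩ := hL.exists_bounds ‖x‖
  obtain ⟨v₀, hv₀⟩ := (hL.proper t ht x).2
  have hv₀dom : v₀ ∈ effDom (L t x) := ⟨hv₀, (hL.proper t ht x).1 v₀⟩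
  have hmem : ∀ v ∈ effDom (L t x), ∀ η, (L t x v).toReal ≤ η → (v, η) ∈ S := by
    intro v hv η hη
    change L t x v ≤ (η : EReal)
    rw [← coe_toReal_of_mem_effDom hv, EReal.coe_le_coe_iff]
    exact hη
  have hq0 : q ≤ 0 := by
    by_contra! hq0
    set η₀ := (L t x v₀).toReal
    have h1 := hfS _ (hmem v₀ hv₀dom (max η₀ ((α - inner ℝ v₀ p) / q)) (le_max_left _ _))
    rw [hf] at h1
    have h2 := mul_le_mul_of_nonneg_right (le_max_right η₀ ((α - inner ℝ v₀ p) / q)) hq0.le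
    rw [div_mul_cancel₀ _ hq0.ne'] at h2
    linarith
  rw [hf] at hfz
  obtain ⟨θ, hθ, hθlt⟩ : ∃ θ > 0, θ * (r + K) < inner ℝ z p + r * q - α := by
    set g := inner ℝ z p + r * q - α with hg
    have hg0 : 0 < g := by linarith
    refine ⟨g / (2 * (|r + K| + 1)), by positivity, ?_⟩
    have h1 : g / (2 * (|r + K| + 1)) * (r + K) ≤ g / (2 * (|r + K| + 1)) * (|r + K| + 1) :=
      mul_le_mul_of_nonneg_left (by linarith [le_abs_self (r + K)]) (by positivity)
    have h2 : g / (2 * (|r + K| + 1)) * (|r + K| + 1) = g / 2 := by field_simp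
    linarith
  have hκ : 0 < θ - q := by linarith
  have key := h ((θ - q)⁻¹ • p) ((α + θ * K) / (θ - q)) (fun v hv => by
    have h1 := hfS _ (hmem v hv _ le_rfl)
    have h2 := (hK t ht x le_rfl v hv).2
    rw [hf] at h1
    rw [inner_smul_right, lt_div_iff₀ hκ, sub_mul, mul_comm, ← mul_assoc, mul_inv_cancel₀ hκ.ne']
    nlinarith)
  rw [inner_smul_right, le_div_iff₀ hκ, sub_mul, mul_comm, ← mul_assoc, mul_inv_cancel₀ hκ.ne']
    at key
  nlinarith

end Triple

end Viability

namespace Viability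

/-! ### Proximal aiming -/

/-- Euler polygons whose velocities point towards `E` stay close to `E`. As long as a point `w` is
`good` and closer than `δ` to `E`, the admissible velocities `f ∈ V w` have norm at most `B` and
can be chosen with `⟪f, w - s⟫ ≤ ε` for a nearest point `s` of `E`. A step of length `h` then
increases the squared distance to `E` by at most `h (2 ε + h B ^ 2)`, so that the distance stays
below `δ` up to the time `τ` if `ε` and `h` are small. Points that are not good are not moved. -/
lemma exists_euler_polygon {F : Type*} [NormedAddCommGroup F] [InnerProductSpace ℝ F]
    {E : Set F} {w₀ : F} (hw₀ : w₀ ∈ E) {good : F → Prop} {V : F → Set F} {B δ τ : ℝ}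
    (hδ : 0 < δ) (hτ : 0 ≤ τ)
    (hV : ∀ ε > 0, ∀ w, good w → Metric.infDist w E < δ →
      ∃ s ∈ E, Metric.infDist w E = dist w s ∧ ∃ f ∈ V w, ‖f‖ ≤ B ∧ inner ℝ f (w - s) ≤ ε) :
    ∃ h : ℝ, 0 < h ∧ h ≤ δ ∧ ∃ w : ℕ → F, w 0 = w₀ ∧ ∀ i : ℕ, i * h ≤ τ →
      Metric.infDist (w i) E < δ ∧
      ((good (w i) ∧ ∃ f ∈ V (w i), w (i + 1) = w i + h • f) ∨
        (¬ good (w i) ∧ w (i + 1) = w i)) := by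
  set ε := δ ^ 2 / (8 * (τ + 1)) with hε
  set h₁ := δ ^ 2 / (4 * (τ + 1) * (B ^ 2 + 1)) with hh₁
  have hε0 : 0 < ε := by positivity
  have hh₁0 : 0 < h₁ := by positivity
  obtain ⟨h, hh, hhδ, hhh₁⟩ : ∃ h > 0, h ≤ δ ∧ h ≤ h₁ :=
    ⟨min δ h₁, lt_min hδ hh₁0, min_le_left _ _, min_le_right _ _⟩
  have hsmall : τ * (2 * ε + h * B ^ 2) < δ ^ 2 := by
    have h1 : (τ + 1) * (2 * ε) = δ ^ 2 / 4 := by rw [hε]; field_simp; norm_num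
    have h2 : (τ + 1) * (h₁ * (B ^ 2 + 1)) = δ ^ 2 / 4 := by rw [hh₁]; field_simp
    have h3 : h * B ^ 2 ≤ h₁ * (B ^ 2 + 1) :=
      mul_le_mul hhh₁ (by linarith) (sq_nonneg B) hh₁0.le
    have h4 : (τ + 1) * (h * B ^ 2) ≤ δ ^ 2 / 4 := by
      rw [← h2]; exact mul_le_mul_of_nonneg_left h3 (by linarith)
    have h5 : 0 ≤ h * B ^ 2 := by positivity
    have h6 : 0 < δ ^ 2 := by positivity
    nlinarith
  have hstep : ∀ w, ∃ w', (good w → Metric.infDist w E < δ → (∃ f ∈ V w, w' = w + h • f) ∧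
      Metric.infDist w' E ^ 2 ≤ Metric.infDist w E ^ 2 + h * (2 * ε + h * B ^ 2)) ∧
      (¬ good w → w' = w) := by
    intro w
    by_cases hg : good w ∧ Metric.infDist w E < δ
    · obtain ⟨s, hs, hds, f, hf, hfB, hfs⟩ := hV ε hε0 w hg.1 hg.2
      refine ⟨w + h • f, fun _ _ => ⟨⟨f, hf, rfl⟩, ?_⟩, fun hn => (hn hg.1).elim⟩
      have h1 : Metric.infDist (w + h • f) E ^ 2 ≤ ‖w - s + h • f‖ ^ 2 := by
        have := Metric.infDist_le_dist_of_mem (x := w + h • f) hs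
        rw [dist_eq_norm, add_sub_right_comm] at this
        have h0 : 0 ≤ Metric.infDist (w + h • f) E := Metric.infDist_nonneg
        gcongr
      refine h1.trans ?_
      rw [norm_add_sq_real, hds, dist_eq_norm, inner_smul_right, real_inner_comm, norm_smul,
        Real.norm_of_nonneg hh.le, mul_pow]
      have h2 : ‖f‖ ^ 2 ≤ B ^ 2 := by gcongr
      have h3 : h * inner ℝ f (w - s) ≤ h * ε := mul_le_mul_of_nonneg_left hfs hh.le
      have h4 : h ^ 2 * ‖f‖ ^ 2 ≤ h ^ 2 * B ^ 2 := mul_le_mul_of_nonneg_left h2 (sq_nonneg h)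
      nlinarith
    · refine ⟨w, fun h1 h2 => (hg ⟨h1, h2⟩).elim, fun _ => rfl⟩
  choose step hmove hstay using hstep
  set w : ℕ → F := fun i => step^[i] w₀ with hw
  have hsucc : ∀ i, w (i + 1) = step (w i) := fun i => Function.iterate_succ_apply' _ _ _
  set κ := h * (2 * ε + h * B ^ 2) with hκ
  have hκ0 : 0 ≤ κ := by positivity
  have hlt : ∀ i : ℕ, i * h ≤ τ → Metric.infDist (w i) E ^ 2 ≤ i * κ →
      Metric.infDist (w i) E < δ := by
    intro i hi hd
    refine lt_of_pow_lt_pow_left₀ 2 hδ.le (hd.trans_lt (lt_of_le_of_lt ?_ hsmall))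
    rw [hκ, ← mul_assoc]
    exact mul_le_mul_of_nonneg_right hi (by positivity)
  have hdist : ∀ i : ℕ, i * h ≤ τ → Metric.infDist (w i) E ^ 2 ≤ i * κ := by
    intro i
    induction i with
    | zero => intro _; simp [hw, Metric.infDist_zero_of_mem hw₀]
    | succ i ih =>
      intro hi
      push_cast at hi ⊢
      have hi' : i * h ≤ τ := by linarith
      rw [hsucc]
      by_cases hg : good (w i)
      · have := (hmove _ hg (hlt i hi' (ih hi'))).2
        linarith [ih hi']
      · rw [hstay _ hg]
        linarith [ih hi']
  refine ⟨h, hh, hhδ, w, rfl, fun i hi => ⟨hlt i hi (hdist i hi), ?_⟩⟩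
  by_cases hg : good (w i)
  · exact Or.inl ⟨hg, by rw [hsucc]; exact (hmove _ hg (hlt i hi (hdist i hi))).1⟩
  · exact Or.inr ⟨hg, by rw [hsucc]; exact hstay _ hg⟩

variable {N : ℕ} {T : ℝ} {U : ℝ → EuclideanSpace ℝ (Fin N) → EReal}
  {L : ℝ → EuclideanSpace ℝ (Fin N) → EuclideanSpace ℝ (Fin N) → EReal}

/-- At a nearest point `s` of the epigraph of `U`, the boundary condition provides velocities that
point towards the epigraph, up to an error `ε`. The slope may be truncated at any level `m`, as the
normal `w - s` has a nonpositive vertical component. -/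
lemma BoundaryCondition.exists_velocity (hbd : BoundaryCondition T L U) (hp : IsProper T U)
    {w s : Triple N} (hs : s ∈ epi T U) (hsT : s.fst < T)
    (hmin : ∀ e ∈ epi T U, ‖w - s‖ ≤ ‖w - e‖) {ε : ℝ} (hε : 0 < ε) :
    ∃ t ∈ Icc 0 T, |t - s.fst| ≤ ε ∧ ∃ y, ‖y - s.snd.fst‖ ≤ ε ∧ ∃ v ∈ effDom (L t y),
      ∀ m : ℝ, inner ℝ (mkTriple 1 v (-min (L t y v).toReal m)) (w - s) ≤ ε := by
  have hdom : s.snd.fst ∈ effDom (U s.fst) :=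
    ⟨ne_top_of_le_ne_top (EReal.coe_ne_top _) hs.2, hp.1 _ hs.1 _⟩
  set r := (U s.fst s.snd.fst).toReal with hr
  have hrU : (r : EReal) = U s.fst s.snd.fst := coe_toReal_of_mem_effDom hdom
  have hrs : r ≤ s.snd.snd := by
    have := hs.2
    rwa [← hrU, EReal.coe_le_coe_iff] at this
  have hadd : mkTriple s.fst s.snd.fst r + mkTriple 0 0 (s.snd.snd - r) = s := by
    conv_rhs => rw [← mkTriple_eta s]
    change mkTriple (s.fst + 0) (s.snd.fst + 0) (r + (s.snd.snd - r)) = _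
    simp
  have hn : w - s ∈ normalCone (epi T U) (mkTriple s.fst s.snd.fst r) := by
    have := sub_mem_normalCone_of_nearest (E := epi T U) (w := w)
      (s := mkTriple s.fst s.snd.fst r) (a := mkTriple 0 0 (s.snd.snd - r))
      ⟨hs.1, hrU.symm.le⟩ (fun e he => add_mkTriple_mem_epi he (by linarith))
      (by rw [hadd]; exact hmin)
    rwa [hadd] at this
  obtain ⟨t, y, v, α, ht, htlim, hylim, hαlim, hv⟩ :=
    hbd s.fst ⟨hs.1.1, hsT⟩ s.snd.fst hdom (w - s) hn
  obtain ⟨k, hk1, hk2, hk3⟩ := ((Metric.tendsto_nhds.mp htlim ε hε).and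
    ((Metric.tendsto_nhds.mp hylim ε hε).and (hαlim.eventually (gt_mem_nhds hε)))).exists
  rw [Real.dist_eq] at hk1
  rw [dist_eq_norm] at hk2
  refine ⟨t k, ht k, hk1.le, y k, hk2.le, v k, (hv k).1, fun m => ?_⟩
  rw [inner_mkTriple]
  have h1 := (hv k).2
  have h2 := snd_snd_sub_nonpos_of_nearest hs hmin
  have h3 : min (L (t k) (y k) (v k)).toReal m ≤ (L (t k) (y k) (v k)).toReal := min_le_left _ _
  nlinarith

/-- The part of the space of triples in which polygons move: the state lies in the ball of
radius `R`, and the time is at most `T - δ`. -/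
def Active (T R δ : ℝ) (w : Triple N) : Prop :=
  ‖w.snd.fst‖ ≤ R ∧ w.fst ≤ T - δ

/-- The velocities `(1, v, -min (L(t,y,v)) m)` for `(t,y)` close to the time and state of `w`. -/
def velocities (T δ m : ℝ)
    (L : ℝ → EuclideanSpace ℝ (Fin N) → EuclideanSpace ℝ (Fin N) → EReal) (w : Triple N) :
    Set (Triple N) :=
  {f | ∃ t ∈ Icc 0 T, |t - w.fst| ≤ 2 * δ ∧ ∃ y, ‖y - w.snd.fst‖ ≤ 2 * δ ∧
    ∃ v ∈ effDom (L t y), f = mkTriple 1 v (-min (L t y v).toReal m)}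

/-- An Euler polygon with step `h` in the space of triples that stays `δ`-close to the epigraph
of `U` up to the parameter `T`. Its velocities belong to `velocities T δ m L`, as long as it is
active, and it rests from then on. -/
structure IsPolygon (T R δ m : ℝ)
    (L : ℝ → EuclideanSpace ℝ (Fin N) → EuclideanSpace ℝ (Fin N) → EReal)
    (U : ℝ → EuclideanSpace ℝ (Fin N) → EReal) (h : ℝ) (w : ℕ → Triple N) : Prop where
  /-- The step is positive. -/
  pos : 0 < h
  /-- The step is at most `δ`. -/
  le : h ≤ δ
  /-- The nodes are close to the epigraph of `U`. -/
  near : ∀ i : ℕ, i * h ≤ T → Metric.infDist (w i) (epi T U) < δ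
  /-- Active nodes move, the others rest. -/
  step : ∀ i : ℕ, i * h ≤ T →
    (Active T R δ (w i) ∧ ∃ f ∈ velocities T δ m L (w i), w (i + 1) = w i + h • f) ∨
      (¬ Active T R δ (w i) ∧ w (i + 1) = w i)

lemma norm_mem_velocities_le {R δ m C K : ℝ} (hδ1 : δ ≤ 1) (hm : 0 ≤ m) (hK0 : 0 ≤ K)
    (hCK : ∀ t ∈ Icc 0 T, ∀ x, ‖x‖ ≤ R + 2 → ∀ v ∈ effDom (L t x),
      ‖v‖ ≤ C ∧ -K ≤ (L t x v).toReal)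
    {w f : Triple N} (hw : ‖w.snd.fst‖ ≤ R) (hf : f ∈ velocities T δ m L w) :
    f.fst = 1 ∧ ‖f.snd.fst‖ ≤ C ∧ f.snd.snd ≤ K ∧ ‖f‖ ≤ 1 + C + (K + m) := by
  obtain ⟨t, ht, -, y, hy, v, hv, rfl⟩ := hf
  have hyR : ‖y‖ ≤ R + 2 := by
    have := norm_sub_norm_le y w.snd.fst
    linarith
  obtain ⟨h1, h2⟩ := hCK t ht y hyR v hv
  have h3 : -K ≤ min (L t y v).toReal m := le_min h2 (by linarith)
  have h4 : min (L t y v).toReal m ≤ m := min_le_right _ _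
  refine ⟨rfl, h1, ?_, ?_⟩
  · rw [mkTriple_snd_snd]; linarith
  · refine (Triple.norm_le _).trans ?_
    rw [mkTriple_fst, mkTriple_snd_fst, mkTriple_snd_snd, abs_one]
    have : |-min (L t y v).toReal m| ≤ K + m := abs_le.mpr ⟨by linarith, by linarith⟩
    linarith

/-- Proximal aiming at the epigraph of `U`. The nodes are so close to the epigraph that the nearest
points of active nodes have times before `T`, where the boundary condition applies. -/
lemma exists_isPolygon (hL : IsLagrangian T L) (hp : IsProper T U)
    (hU : LowerSemicontinuousOn
      (fun p : ℝ × EuclideanSpace ℝ (Fin N) => U p.1 p.2) (Icc 0 T ×ˢ univ))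
    (hbd : BoundaryCondition T L U) (hT : 0 ≤ T) {w₀ : Triple N} (hw₀ : w₀ ∈ epi T U) (R : ℝ)
    {δ m : ℝ} (hδ : 0 < δ) (hδ1 : δ ≤ 1) (hm : 0 ≤ m) :
    ∃ h w, IsPolygon T R δ m L U h w ∧ w 0 = w₀ := by
  obtain ⟨C, K, -, hK0, hCK⟩ := hL.exists_bounds (R + 2)
  obtain ⟨h, hh, hhδ, w, hw0, hw⟩ := exists_euler_polygon (E := epi T U) hw₀
    (good := Active T R δ) (V := velocities T δ m L) (B := 1 + C + (K + m)) hδ hT (by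
      intro ε hε w hgood hdist
      obtain ⟨s, hs, hds⟩ := (isClosed_epi hU).exists_infDist_eq_dist ⟨w₀, hw₀⟩ w
      have hmin : ∀ e ∈ epi T U, ‖w - s‖ ≤ ‖w - e‖ := by
        intro e he
        rw [← dist_eq_norm, ← dist_eq_norm, ← hds]
        exact Metric.infDist_le_dist_of_mem he
      have hsw : ‖s - w‖ < δ := by rwa [← dist_eq_norm, dist_comm, ← hds]
      have h1 : |s.fst - w.fst| < δ := (Triple.abs_fst_le (s - w)).trans_lt hsw
      have h2 : ‖s.snd.fst - w.snd.fst‖ < δ := (Triple.norm_snd_fst_le (s - w)).trans_lt hsw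
      have hsT : s.fst < T := by linarith [le_abs_self (s.fst - w.fst), hgood.2]
      obtain ⟨t, ht, hts, y, hys, v, hv, hvel⟩ :=
        hbd.exists_velocity hp hs hsT hmin (lt_min hε hδ)
      have hf : mkTriple 1 v (-min (L t y v).toReal m) ∈ velocities T δ m L w := by
        refine ⟨t, ht, ?_, y, ?_, v, hv, rfl⟩
        · linarith [abs_sub_le t s.fst w.fst, min_le_right ε δ]
        · linarith [norm_sub_le_norm_sub_add_norm_sub y s.snd.fst w.snd.fst, min_le_right ε δ]
      exact ⟨s, hs, hds, _, hf, (norm_mem_velocities_le hδ1 hm hK0 hCK hgood.1 hf).2.2.2,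
        (hvel m).trans (min_le_left _ _)⟩)
  exact ⟨h, w, ⟨hh, hhδ, fun i hi => (hw i hi).1, fun i hi => (hw i hi).2⟩, hw0⟩

end Viability

namespace Viability

/-! ### Estimates along polygons -/

lemma sub_le_mul_of_step_le {a : ℕ → ℝ} {c : ℝ} {i j : ℕ} (hij : i ≤ j)
    (h : ∀ k, i ≤ k → k < j → a (k + 1) ≤ a k + c) : a j - a i ≤ c * ((j : ℝ) - i) := by
  induction j, hij using Nat.le_induction with
  | base => simp
  | succ j hij ih =>
    have h1 := ih fun k hk hkj => h k hk (by omega)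
    have h2 := h j hij (by omega)
    push_cast
    linarith

variable {N : ℕ} {T : ℝ} {U : ℝ → EuclideanSpace ℝ (Fin N) → EReal}
  {L : ℝ → EuclideanSpace ℝ (Fin N) → EuclideanSpace ℝ (Fin N) → EReal}

namespace IsPolygon

variable {R δ m h : ℝ} {w : ℕ → Triple N}

lemma mul_le_of_le (hw : IsPolygon T R δ m L U h w) {i j : ℕ} (hij : i ≤ j) (hj : j * h ≤ T) :
    i * h ≤ T := by
  have := hw.pos
  have : (i : ℝ) * h ≤ j * h := by gcongr
  linarith

/-- Nodes that are not active rest forever. -/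
lemma active_of_le (hw : IsPolygon T R δ m L U h w) {i j : ℕ} (hij : i ≤ j) (hj : j * h ≤ T)
    (ha : Active T R δ (w j)) : Active T R δ (w i) := by
  by_contra hi
  have : w j = w i := by
    clear ha
    induction j, hij using Nat.le_induction with
    | base => rfl
    | succ j hij ih =>
      have hj' := hw.mul_le_of_le j.le_succ hj
      have h1 := ih hj'
      rcases hw.step j hj' with h2 | h2
      · rw [h1] at h2; exact (hi h2.1).elim
      · rw [h2.2, h1]
  rw [this] at ha
  exact hi ha

lemma fst_eq (hw : IsPolygon T R δ m L U h w) {j : ℕ} (hj : j * h ≤ T)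
    (ha : Active T R δ (w j)) : (w j).fst = (w 0).fst + j * h := by
  induction j with
  | zero => simp
  | succ j ih =>
    have hj' := hw.mul_le_of_le j.le_succ hj
    have ha' := hw.active_of_le j.le_succ hj ha
    rcases hw.step j hj' with ⟨-, f, ⟨t, -, -, y, -, v, -, rfl⟩, h2⟩ | h2
    · rw [h2]
      change (w j).fst + h * 1 = _
      rw [ih hj' ha']
      push_cast
      ring
    · exact (h2.1 ha').elim

lemma abs_fst_sub_le (hw : IsPolygon T R δ m L U h w) {i j : ℕ} (hij : i ≤ j) (hj : j * h ≤ T) :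
    |(w j).fst - (w i).fst| ≤ h * ((j : ℝ) - i) := by
  have := sub_le_mul_of_step_le (a := fun k => |(w k).fst - (w i).fst|) (c := h) hij
    fun k _ hkj => by
      rcases hw.step k (hw.mul_le_of_le hkj.le hj) with ⟨-, f, ⟨t, -, -, y, -, v, -, rfl⟩, h2⟩ | h2
      · rw [h2]
        change |(w k).fst + h * 1 - (w i).fst| ≤ _
        rw [mul_one, add_sub_right_comm]
        exact (abs_add_le _ _).trans (by rw [abs_of_pos hw.pos])
      · rw [h2.2]; linarith [hw.pos]
  simpa using this

section Bounds

variable {C K : ℝ} (hCK : ∀ t ∈ Icc 0 T, ∀ x, ‖x‖ ≤ R + 2 → ∀ v ∈ effDom (L t x),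
      ‖v‖ ≤ C ∧ -K ≤ (L t x v).toReal)
include hCK

lemma norm_snd_fst_sub_le (hw : IsPolygon T R δ m L U h w) (hδ1 : δ ≤ 1) (hm : 0 ≤ m)
    (hC0 : 0 ≤ C) (hK0 : 0 ≤ K) {i j : ℕ} (hij : i ≤ j) (hj : j * h ≤ T) :
    ‖(w j).snd.fst - (w i).snd.fst‖ ≤ h * C * ((j : ℝ) - i) := by
  have hh := hw.pos
  have := sub_le_mul_of_step_le (a := fun k => ‖(w k).snd.fst - (w i).snd.fst‖) (c := h * C) hij
    fun k _ hkj => by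
      rcases hw.step k (hw.mul_le_of_le hkj.le hj) with ⟨ha, f, hf, h2⟩ | h2
      · have h3 := (norm_mem_velocities_le hδ1 hm hK0 hCK ha.1 hf).2.1
        rw [h2]
        change ‖(w k).snd.fst + h • f.snd.fst - (w i).snd.fst‖ ≤ _
        rw [add_sub_right_comm]
        refine (norm_add_le _ _).trans ?_
        rw [norm_smul, Real.norm_of_nonneg hh.le]
        gcongr
      · rw [h2.2]; linarith [mul_nonneg hh.le hC0]
  simpa using this

lemma snd_snd_sub_le (hw : IsPolygon T R δ m L U h w) (hδ1 : δ ≤ 1) (hm : 0 ≤ m)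
    (hK0 : 0 ≤ K) {i j : ℕ} (hij : i ≤ j) (hj : j * h ≤ T) :
    (w j).snd.snd - (w i).snd.snd ≤ h * K * ((j : ℝ) - i) := by
  have hh := hw.pos
  refine sub_le_mul_of_step_le (a := fun k => (w k).snd.snd) hij fun k _ hkj => ?_
  rcases hw.step k (hw.mul_le_of_le hkj.le hj) with ⟨ha, f, hf, h2⟩ | h2
  · have h3 := (norm_mem_velocities_le hδ1 hm hK0 hCK ha.1 hf).2.2.1
    rw [h2]
    change (w k).snd.snd + h * f.snd.snd ≤ _
    gcongr
  · rw [h2.2]; linarith [mul_nonneg hh.le hK0]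

/-- Polygons remain in a ball that depends on the data and the starting point only. -/
lemma norm_le (hw : IsPolygon T R δ m L U h w) (hδ1 : δ ≤ 1) (hm : 0 ≤ m)
    (hC0 : 0 ≤ C) (hK0 : 0 ≤ K) (hne : (epi T U).Nonempty) {K' : ℝ}
    (hK' : ∀ e ∈ epi T U, ‖e.snd.fst‖ ≤ ‖(w 0).snd.fst‖ + C * T + 1 → -K' ≤ e.snd.snd)
    {j : ℕ} (hj : j * h ≤ T) :
    ‖w j‖ ≤ (|(w 0).fst| + T) + (‖(w 0).snd.fst‖ + C * T) +
      (|(w 0).snd.snd| + K * T + |K'| + 1) := by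
  have h1 := hw.abs_fst_sub_le (Nat.zero_le j) hj
  have h2 := hw.norm_snd_fst_sub_le hCK hδ1 hm hC0 hK0 (Nat.zero_le j) hj
  have h3 := hw.snd_snd_sub_le hCK hδ1 hm hK0 (Nat.zero_le j) hj
  simp only [Nat.cast_zero, sub_zero] at h1 h2 h3
  have hCj : h * C * j ≤ C * T := by nlinarith
  have hKj : h * K * j ≤ K * T := by nlinarith
  have hx : ‖(w j).snd.fst‖ ≤ ‖(w 0).snd.fst‖ + C * T := by
    linarith [norm_sub_norm_le (w j).snd.fst (w 0).snd.fst]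
  have ht : |(w j).fst| ≤ |(w 0).fst| + T := by
    linarith [abs_sub_abs_le_abs_sub (w j).fst (w 0).fst]
  obtain ⟨e, he, hde⟩ := (Metric.infDist_lt_iff hne).mp ((hw.near j hj).trans_le hδ1)
  rw [dist_comm, dist_eq_norm] at hde
  have h4 : ‖e.snd.fst - (w j).snd.fst‖ < 1 := (Triple.norm_snd_fst_le (e - w j)).trans_lt hde
  have h5 : |e.snd.snd - (w j).snd.snd| < 1 := (Triple.abs_snd_snd_le (e - w j)).trans_lt hde
  have h6 := hK' e he (by linarith [norm_sub_norm_le e.snd.fst (w j).snd.fst])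
  have hu : |(w j).snd.snd| ≤ |(w 0).snd.snd| + K * T + |K'| + 1 := by
    have h7 : 0 ≤ K * T := by
      have : 0 ≤ h * K * j := mul_nonneg (mul_nonneg hw.pos.le hK0) (Nat.cast_nonneg j)
      linarith
    rw [abs_le]
    constructor
    · linarith [le_abs_self K', abs_nonneg (w 0).snd.snd, le_abs_self (e.snd.snd - (w j).snd.snd)]
    · linarith [le_abs_self (w 0).snd.snd, abs_nonneg K']
  linarith [Triple.norm_le (w j)]

end Bounds

/-- An upper bound `β` for the truncated Hamiltonian near the nodes bounds the increments of
`⟪x, p⟫ + u`. -/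
lemma inner_sub_add_le (hw : IsPolygon T R δ m L U h w) {p : EuclideanSpace ℝ (Fin N)} {β : ℝ}
    {i j : ℕ} (hij : i ≤ j) (hj : j * h ≤ T) (ha : Active T R δ (w j))
    (hβ : ∀ k, i ≤ k → k < j → ∀ t ∈ Icc 0 T, |t - (w k).fst| ≤ 2 * δ →
      ∀ y, ‖y - (w k).snd.fst‖ ≤ 2 * δ → ∀ v ∈ effDom (L t y),
        inner ℝ v p - min (L t y v).toReal m ≤ β) :
    inner ℝ ((w j).snd.fst - (w i).snd.fst) p + ((w j).snd.snd - (w i).snd.snd) ≤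
      h * β * ((j : ℝ) - i) := by
  have := sub_le_mul_of_step_le (a := fun k => inner ℝ (w k).snd.fst p + (w k).snd.snd)
    (c := h * β) hij fun k hk hkj => by
      have hk' := hw.mul_le_of_le hkj.le hj
      rcases hw.step k hk' with ⟨-, f, ⟨t, ht, htk, y, hy, v, hv, rfl⟩, h2⟩ | h2
      · rw [h2]
        change inner ℝ ((w k).snd.fst + h • v) p + ((w k).snd.snd + h * -min (L t y v).toReal m) ≤ _
        rw [inner_add_left, real_inner_smul_left]
        have := mul_le_mul_of_nonneg_left (hβ k hk hkj t ht htk y hy v hv) hw.pos.le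
        linarith
      · exact (h2.1 (hw.active_of_le hkj.le hj ha)).elim
  rw [inner_sub_left]
  linarith

end IsPolygon

/-! ### Limits of polygons -/

section Limit

/-- The number of the time step of length `h`, counted from `t₀`, that contains `t`. -/
noncomputable def stepIndex (t₀ h t : ℝ) : ℕ := ⌊(t - t₀) / h⌋₊

lemma stepIndex_mul_le {t₀ h t : ℝ} (hh : 0 < h) (ht : t₀ ≤ t) :
    stepIndex t₀ h t * h ≤ t - t₀ := by
  rw [← le_div_iff₀ hh]
  exact Nat.floor_le (div_nonneg (by linarith) hh.le)

lemma lt_stepIndex_mul_add {t₀ h t : ℝ} (hh : 0 < h) :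
    t - t₀ < stepIndex t₀ h t * h + h := by
  have := Nat.lt_floor_add_one ((t - t₀) / h)
  rw [div_lt_iff₀ hh] at this
  rw [stepIndex]
  linarith

lemma stepIndex_mono {t₀ h s t : ℝ} (hh : 0 < h) (hst : s ≤ t) :
    stepIndex t₀ h s ≤ stepIndex t₀ h t := by
  unfold stepIndex; gcongr

lemma abs_stepIndex_sub_le {t₀ h s t : ℝ} (hh : 0 < h) (hs : t₀ ≤ s) (ht : t₀ ≤ t) :
    |h * ((stepIndex t₀ h t : ℝ) - stepIndex t₀ h s) - (t - s)| ≤ h := by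
  have h1 := stepIndex_mul_le hh hs
  have h2 := stepIndex_mul_le hh ht
  have h3 := lt_stepIndex_mul_add (t₀ := t₀) (t := s) hh
  have h4 := lt_stepIndex_mul_add (t₀ := t₀) (t := t) hh
  rw [abs_le]
  constructor <;> linarith

lemma tendsto_stepIndex_sub {l : Filter ℕ} {h : ℕ → ℝ} (hh : ∀ n, 0 < h n)
    (hlim : Tendsto h l (𝓝 0)) {t₀ s t : ℝ} (hs : t₀ ≤ s) (ht : t₀ ≤ t) :
    Tendsto (fun n => h n * ((stepIndex t₀ (h n) t : ℝ) - stepIndex t₀ (h n) s)) l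
      (𝓝 (t - s)) := by
  rw [tendsto_iff_dist_tendsto_zero]
  exact squeeze_zero (fun _ => dist_nonneg)
    (fun n => abs_stepIndex_sub_le (hh n) hs ht) hlim

/-- A pointwise limit `z` of polygons starting at a point `w₀` of the epigraph. The bounds `C` and
`K` limit the velocities of the state and of the vertical component as long as the polygons move.
-/
structure IsLimitCurve (T R C K : ℝ)
    (L : ℝ → EuclideanSpace ℝ (Fin N) → EuclideanSpace ℝ (Fin N) → EReal)
    (U : ℝ → EuclideanSpace ℝ (Fin N) → EReal) (w₀ : Triple N) (z : ℝ → Triple N) : Prop where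
  /-- The curve starts at `w₀`. -/
  start : z w₀.fst = w₀
  /-- The curve stays in the epigraph. -/
  mem_epi : ∀ t ∈ Icc w₀.fst T, z t ∈ epi T U
  /-- The state is Lipschitz continuous. -/
  norm_sub_le : ∀ s t, w₀.fst ≤ s → s ≤ t → t ≤ T →
    ‖(z t).snd.fst - (z s).snd.fst‖ ≤ C * (t - s)
  /-- The vertical component grows at most linearly. -/
  sub_le : ∀ s t, w₀.fst ≤ s → s ≤ t → t ≤ T → (z t).snd.snd - (z s).snd.snd ≤ K * (t - s)
  /-- Inside the ball the curve is parametrized by time. -/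
  fst_eq : ∀ t ∈ Ico w₀.fst T, ‖(z t).snd.fst‖ < R → (z t).fst = t
  /-- Upper bounds of the Hamiltonian near a point of the curve bound the increments. -/
  inner_sub_add_le : ∀ s t, w₀.fst ≤ s → s ≤ t → t < T → ‖(z t).snd.fst‖ < R →
    ∀ (p : EuclideanSpace ℝ (Fin N)) (β ρ : ℝ),
      (∀ r ∈ Icc 0 T, |r - s| < ρ → ∀ y, ‖y - (z s).snd.fst‖ < ρ → ∀ v ∈ effDom (L r y),
        inner ℝ v p - (L r y v).toReal < β) →
      t - s < ρ → C * (t - s) < ρ →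
      inner ℝ ((z t).snd.fst - (z s).snd.fst) p + ((z t).snd.snd - (z s).snd.snd) ≤ β * (t - s)

/-- The limit is taken along an ultrafilter, for polygons that are `1 / (n + 1)`-close to the epigraph
and have slopes truncated at the level `n`. A Lipschitz bound for the state holds in the limit
although the velocities are not bounded in the vertical direction. -/
lemma exists_isLimitCurve (hL : IsLagrangian T L) (hp : IsProper T U)
    (hU : LowerSemicontinuousOn
      (fun p : ℝ × EuclideanSpace ℝ (Fin N) => U p.1 p.2) (Icc 0 T ×ˢ univ))
    (hbd : BoundaryCondition T L U) (hT : 0 ≤ T) {w₀ : Triple N} (hw₀ : w₀ ∈ epi T U) (R : ℝ) :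
    ∃ C K z, 0 ≤ C ∧ IsLimitCurve T R C K L U w₀ z := by
  obtain ⟨C, K, hC0, hK0, hCK⟩ := hL.exists_bounds (R + 2)
  obtain ⟨K', hK'⟩ := exists_lower_bound_of_isProper hU hp (‖w₀.snd.fst‖ + C * T + 1)
  set δ : ℕ → ℝ := fun n => 1 / ((n : ℝ) + 1) with hδdef
  have hδ0 : ∀ n, 0 < δ n := fun n => by positivity
  have hδ1 : ∀ n, δ n ≤ 1 := fun n => by
    rw [hδdef, div_le_one (by positivity)]; linarith [Nat.cast_nonneg (α := ℝ) n]
  choose h w hw hw0 using fun n : ℕ =>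
    exists_isPolygon hL hp hU hbd hT hw₀ R (hδ0 n) (hδ1 n) (Nat.cast_nonneg (α := ℝ) n)
  set t₀ := w₀.fst with ht₀
  have ht₀0 : 0 ≤ t₀ := hw₀.1.1
  set 𝒰 : Ultrafilter ℕ := hyperfilter ℕ with h𝒰
  have h𝒰le : (𝒰 : Filter ℕ) ≤ atTop := Nat.hyperfilter_le_atTop
  have hhpos : ∀ n, 0 < h n := fun n => (hw n).pos
  have hδlim : Tendsto δ 𝒰 (𝓝 0) := tendsto_one_div_add_atTop_nhds_zero_nat.mono_left h𝒰le
  have hhlim : Tendsto h 𝒰 (𝓝 0) :=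
    squeeze_zero (fun n => (hhpos n).le) (fun n => (hw n).le) hδlim
  have hidx : ∀ n, ∀ t ∈ Icc t₀ T, stepIndex t₀ (h n) t * h n ≤ T := fun n t ht => by
    linarith [stepIndex_mul_le (hhpos n) ht.1, ht.2]
  have hlim : ∀ t, ∃ z, t ∈ Icc t₀ T →
      Tendsto (fun n => w n (stepIndex t₀ (h n) t)) 𝒰 (𝓝 z) := by
    intro t
    by_cases ht : t ∈ Icc t₀ T
    · have hb : ∀ n, w n (stepIndex t₀ (h n) t) ∈ Metric.closedBall (0 : Triple N)
          ((|w₀.fst| + T) + (‖w₀.snd.fst‖ + C * T) + (|w₀.snd.snd| + K * T + |K'| + 1)) := by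
        intro n
        have := (hw n).norm_le hCK (hδ1 n) (Nat.cast_nonneg n) hC0 hK0 ⟨w₀, hw₀⟩
          (K' := K') (by rw [hw0]; exact hK') (hidx n t ht)
        rw [hw0] at this
        simpa using this
      obtain ⟨z, -, hz⟩ := (isCompact_closedBall (0 : Triple N) _).ultrafilter_le_nhds
        (𝒰.map fun n => w n (stepIndex t₀ (h n) t))
        (le_principal_iff.mpr (mem_map.mpr (Eventually.of_forall hb)))
      exact ⟨z, fun _ => hz⟩
    · exact ⟨0, fun h => (ht h).elim⟩
  choose z hz using hlim
  have hzx : ∀ t ∈ Icc t₀ T,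
      Tendsto (fun n => (w n (stepIndex t₀ (h n) t)).snd.fst) 𝒰 (𝓝 (z t).snd.fst) :=
    fun t ht => (Triple.continuous_snd_fst.tendsto _).comp (hz t ht)
  have hzu : ∀ t ∈ Icc t₀ T,
      Tendsto (fun n => (w n (stepIndex t₀ (h n) t)).snd.snd) 𝒰 (𝓝 (z t).snd.snd) :=
    fun t ht => (Triple.continuous_snd_snd.tendsto _).comp (hz t ht)
  -- Before the final time, a limit state inside the ball comes from active nodes.
  have hactive : ∀ t ∈ Ico t₀ T, ‖(z t).snd.fst‖ < R →
      ∀ᶠ n in (𝒰 : Filter ℕ), Active T R (δ n) (w n (stepIndex t₀ (h n) t)) := by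
    intro t ht hR
    have ht' : t ∈ Icc t₀ T := Ico_subset_Icc_self ht
    filter_upwards [(hzx t ht').norm.eventually (gt_mem_nhds hR),
      hδlim.eventually (gt_mem_nhds (sub_pos.mpr ht.2))] with n h1 h2
    refine ⟨h1.le, ?_⟩
    have h3 := (hw n).abs_fst_sub_le (Nat.zero_le _) (hidx n t ht')
    have h4 := stepIndex_mul_le (hhpos n) ht'.1
    rw [hw0, Nat.cast_zero, sub_zero, ← ht₀] at h3
    linarith [le_abs_self ((w n (stepIndex t₀ (h n) t)).fst - t₀)]
  refine ⟨C, K, z, hC0, ?_, ?_, ?_, ?_, ?_, ?_⟩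
  · by_cases h0 : t₀ ∈ Icc t₀ T
    · refine tendsto_nhds_unique (hz t₀ h0) ?_
      have : (fun n => w n (stepIndex t₀ (h n) t₀)) = fun _ => w₀ := by
        funext n; simp [stepIndex, hw0]
      rw [this]
      exact tendsto_const_nhds
    · exact (h0 ⟨le_rfl, hw₀.1.2⟩).elim
  · intro t ht
    have h1 : Tendsto (fun n => Metric.infDist (w n (stepIndex t₀ (h n) t)) (epi T U)) 𝒰
        (𝓝 (Metric.infDist (z t) (epi T U))) :=
      ((Metric.continuous_infDist_pt _).tendsto _).comp (hz t ht)
    have h2 : Metric.infDist (z t) (epi T U) = 0 := tendsto_nhds_unique h1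
      (squeeze_zero (fun _ => Metric.infDist_nonneg)
        (fun n => ((hw n).near _ (hidx n t ht)).le) hδlim)
    exact ((isClosed_epi hU).mem_iff_infDist_zero ⟨w₀, hw₀⟩).mpr h2
  · intro s t hs hst htT
    have hsI : s ∈ Icc t₀ T := ⟨hs, hst.trans htT⟩
    have htI : t ∈ Icc t₀ T := ⟨hs.trans hst, htT⟩
    refine le_of_tendsto_of_tendsto' ((hzx t htI).sub (hzx s hsI)).norm
      ((tendsto_stepIndex_sub hhpos hhlim hs htI.1).const_mul C) fun n => ?_
    have := (hw n).norm_snd_fst_sub_le hCK (hδ1 n) (Nat.cast_nonneg n) hC0 hK0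
      (stepIndex_mono (t₀ := t₀) (hhpos n) hst) (hidx n t htI)
    linarith
  · intro s t hs hst htT
    have hsI : s ∈ Icc t₀ T := ⟨hs, hst.trans htT⟩
    have htI : t ∈ Icc t₀ T := ⟨hs.trans hst, htT⟩
    refine le_of_tendsto_of_tendsto' ((hzu t htI).sub (hzu s hsI))
      ((tendsto_stepIndex_sub hhpos hhlim hs htI.1).const_mul K) fun n => ?_
    have := (hw n).snd_snd_sub_le hCK (hδ1 n) (Nat.cast_nonneg n) hK0
      (stepIndex_mono (t₀ := t₀) (hhpos n) hst) (hidx n t htI)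
    linarith
  · intro t ht hR
    have ht' : t ∈ Icc t₀ T := Ico_subset_Icc_self ht
    have h1 : Tendsto (fun n => (w n (stepIndex t₀ (h n) t)).fst) 𝒰 (𝓝 (z t).fst) :=
      (Triple.continuous_fst.tendsto _).comp (hz t ht')
    have h2 := (tendsto_stepIndex_sub hhpos hhlim (le_refl t₀) ht'.1).const_add t₀
    rw [add_sub_cancel] at h2
    refine tendsto_nhds_unique h1 (h2.congr' ?_)
    filter_upwards [hactive t ht hR] with n hn
    rw [(hw n).fst_eq (hidx n t ht') hn, hw0]
    simp [stepIndex, mul_comm, ht₀]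
  · intro s t hs hst htT hR p β ρ hβ hρ hCρ
    have hsI : s ∈ Icc t₀ T := ⟨hs, (hst.trans_lt htT).le⟩
    have htI : t ∈ Icc t₀ T := ⟨hs.trans hst, htT.le⟩
    have hsub := tendsto_stepIndex_sub hhpos hhlim hs htI.1
    refine le_of_tendsto_of_tendsto
      ((((hzx t htI).sub (hzx s hsI)).inner tendsto_const_nhds).add ((hzu t htI).sub (hzu s hsI)))
      (hsub.const_mul β) ?_
    have hE1 : ∀ᶠ n in (𝒰 : Filter ℕ), 2 * δ n + h n + (t - s) < ρ := by
      have : Tendsto (fun n => 2 * δ n + h n + (t - s)) 𝒰 (𝓝 (2 * 0 + 0 + (t - s))) :=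
        ((hδlim.const_mul 2).add hhlim).add_const _
      exact this.eventually (gt_mem_nhds (by linarith))
    have hE2 : ∀ᶠ n in (𝒰 : Filter ℕ), 2 * δ n + C * (h n *
        ((stepIndex t₀ (h n) t : ℝ) - stepIndex t₀ (h n) s)) +
        ‖(w n (stepIndex t₀ (h n) s)).snd.fst - (z s).snd.fst‖ < ρ := by
      have h1 := (tendsto_iff_norm_sub_tendsto_zero.mp (hzx s hsI))
      have := ((hδlim.const_mul 2).add (hsub.const_mul C)).add h1
      exact this.eventually (gt_mem_nhds (by linarith))
    have hE3 : ∀ᶠ n : ℕ in (𝒰 : Filter ℕ), C * ‖p‖ - β ≤ n :=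
      h𝒰le (tendsto_natCast_atTop_atTop.eventually_ge_atTop _)
    filter_upwards [hE1, hE2, hE3, hactive t ⟨htI.1, htT⟩ hR] with n h1 h2 h3 ha
    have hmono := stepIndex_mono (t₀ := t₀) (hhpos n) hst
    have hjT := hidx n t htI
    have := (hw n).inner_sub_add_le (p := p) (β := β) hmono hjT ha (by
      intro k hk hkj r hr hrk y hy v hv
      have hkT := (hw n).mul_le_of_le hkj.le hjT
      have hak := (hw n).active_of_le hkj.le hjT ha
      have hyR : ‖y‖ ≤ R + 2 := by
        linarith [norm_sub_norm_le y (w n k).snd.fst, hak.1, hδ1 n]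
      have hvC := (hCK r hr y hyR v hv).1
      have hin : inner ℝ v p ≤ C * ‖p‖ :=
        (real_inner_le_norm v p).trans (mul_le_mul_of_nonneg_right hvC (norm_nonneg p))
      have hmain : inner ℝ v p - (L r y v).toReal < β := by
        refine hβ r hr ?_ y ?_ v hv
        · have hkfst := (hw n).fst_eq hkT hak
          rw [hw0, ← ht₀] at hkfst
          have hlow := lt_stepIndex_mul_add (t₀ := t₀) (t := s) (hhpos n)
          have hup := stepIndex_mul_le (hhpos n) htI.1
          have hh0 := (hhpos n).le
          have c1 : (stepIndex t₀ (h n) s : ℝ) * h n ≤ k * h n := by gcongr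
          have c2 : (k : ℝ) * h n ≤ stepIndex t₀ (h n) t * h n := by gcongr
          have c3 : |(w n k).fst - s| ≤ h n + (t - s) := by
            rw [hkfst, abs_le]; constructor <;> linarith
          linarith [abs_sub_le r (w n k).fst s]
        · have c1 := (hw n).norm_snd_fst_sub_le hCK (hδ1 n) (Nat.cast_nonneg n) hC0 hK0 hk hkT
          have hh0 := (hhpos n).le
          have c2 : (k : ℝ) ≤ stepIndex t₀ (h n) t := by exact_mod_cast hkj.le
          have c3 : h n * C * ((k : ℝ) - stepIndex t₀ (h n) s) ≤
              h n * C * ((stepIndex t₀ (h n) t : ℝ) - stepIndex t₀ (h n) s) :=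
            mul_le_mul_of_nonneg_left (by linarith) (mul_nonneg hh0 hC0)
          have c4 := norm_sub_le_norm_sub_add_norm_sub y (w n k).snd.fst (z s).snd.fst
          have c5 := norm_sub_le_norm_sub_add_norm_sub (w n k).snd.fst
            (w n (stepIndex t₀ (h n) s)).snd.fst (z s).snd.fst
          linarith
      rcases min_cases (L r y v).toReal (n : ℝ) with ⟨e, -⟩ | ⟨e, -⟩ <;> rw [e] <;> linarith)
    linarith

end Limit

end Viability

namespace Viability

/-! ### The limit curve solves the differential inclusion -/

variable {N : ℕ} {T : ℝ} {U : ℝ → EuclideanSpace ℝ (Fin N) → EReal}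
  {L : ℝ → EuclideanSpace ℝ (Fin N) → EuclideanSpace ℝ (Fin N) → EReal}

lemma IsLimitCurve.lipschitzOnWith {R C K : ℝ} {w₀ : Triple N} {z : ℝ → Triple N}
    (hz : IsLimitCurve T R C K L U w₀ z) (hC : 0 ≤ C) :
    LipschitzOnWith C.toNNReal (fun t => (z t).snd.fst) (Icc w₀.fst T) := by
  refine LipschitzOnWith.of_dist_le_mul fun s hs t ht => ?_
  rw [Real.coe_toNNReal _ hC]
  rcases le_total s t with h | h
  · rw [dist_comm, dist_comm s, dist_eq_norm, Real.dist_eq, abs_of_nonneg (by linarith)]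
    exact hz.norm_sub_le s t hs.1 h ht.2
  · rw [dist_eq_norm, Real.dist_eq, abs_of_nonneg (by linarith)]
    exact hz.norm_sub_le t s ht.1 h hs.2

lemma IsLimitCurve.monotoneOn {R C K : ℝ} {w₀ : Triple N} {z : ℝ → Triple N}
    (hz : IsLimitCurve T R C K L U w₀ z) :
    MonotoneOn (fun t => K * t - (z t).snd.snd) (Icc w₀.fst T) := by
  intro s hs t ht hst
  have := hz.sub_le s t hs.1 hst ht.2
  simp only
  linarith

/-- Where the limit curve is differentiable, its derivative belongs to `Q`. -/
lemma IsLimitCurve.le_of_hasDerivAt {R C K : ℝ} {w₀ : Triple N} {z : ℝ → Triple N}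
    (hz : IsLimitCurve T R C K L U w₀ z) (hL : IsLagrangian T L) (h0 : 0 ≤ w₀.fst) {t : ℝ}
    (ht : t ∈ Ico w₀.fst T) (hR : ‖(z t).snd.fst‖ < R) {v : EuclideanSpace ℝ (Fin N)} {η : ℝ}
    (hx : HasDerivAt (fun s => (z s).snd.fst) v t) (hu : HasDerivAt (fun s => (z s).snd.snd) η t) :
    L t (z t).snd.fst v ≤ ((-η : ℝ) : EReal) := by
  refine hL.le_of_forall_inner_sub_le ⟨h0.trans ht.1, ht.2.le⟩ fun p β hβ => ?_
  obtain ⟨ρ, hρ, hH⟩ := hL.exists_nhds_inner_sub_lt hβ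
  have hxs := (hasDerivAt_iff_tendsto_slope.mp hx).mono_left
    (nhdsWithin_mono t (fun s (hs : s ∈ Ioi t) => ne_of_gt hs))
  have hus := (hasDerivAt_iff_tendsto_slope.mp hu).mono_left
    (nhdsWithin_mono t (fun s (hs : s ∈ Ioi t) => ne_of_gt hs))
  have hlim := (hxs.inner (tendsto_const_nhds (x := p))).add hus
  rw [sub_neg_eq_add]
  refine le_of_tendsto hlim ?_
  have hC : Tendsto (fun s => C * (s - t)) (𝓝 t) (𝓝 0) := by
    have : Tendsto (fun s => C * (s - t)) (𝓝 t) (𝓝 (C * (t - t))) :=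
      (continuous_const.mul (continuous_id.sub continuous_const)).tendsto t
    rwa [sub_self, mul_zero] at this
  filter_upwards [self_mem_nhdsWithin, nhdsWithin_le_nhds (gt_mem_nhds ht.2),
    nhdsWithin_le_nhds (gt_mem_nhds (show t < t + ρ by linarith)),
    nhdsWithin_le_nhds (hC.eventually (gt_mem_nhds hρ)),
    nhdsWithin_le_nhds (hx.continuousAt.norm.eventually (gt_mem_nhds hR))] with s h1 h2 h3 h4 h5
  have h1 : t < s := h1
  have hst : 0 < s - t := sub_pos.mpr h1
  have := hz.inner_sub_add_le t s ht.1 h1.le h2 h5 p β ρ hH (by linarith) h4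
  rw [slope_def_module, slope_def_module, real_inner_smul_left, smul_eq_mul, ← mul_add,
    inv_mul_le_iff₀ hst, mul_comm]
  linarith

/-! ### The a priori bound -/

lemma abs_log_one_add_sq_sub_le (a b : ℝ) :
    |Real.log (1 + a ^ 2) - Real.log (1 + b ^ 2)| ≤ |a - b| := by
  have hd : ∀ s : ℝ, HasDerivAt (fun s : ℝ => Real.log (1 + s ^ 2)) (2 * s / (1 + s ^ 2)) s := by
    intro s
    have h1 : HasDerivAt (fun s : ℝ => 1 + s ^ 2) (2 * s) s := by
      simpa using (hasDerivAt_pow 2 s).const_add 1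
    exact h1.log (by positivity)
  have := Convex.norm_image_sub_le_of_norm_hasDerivWithin_le (C := 1) (x := b) (y := a)
    (fun s _ => (hd s).hasDerivWithinAt) (fun s _ => ?_) convex_univ (mem_univ _) (mem_univ _)
  · simpa using this
  · rw [Real.norm_eq_abs, abs_le]
    have : 0 < 1 + s ^ 2 := by positivity
    constructor
    · rw [le_div_iff₀ this]; nlinarith [sq_nonneg (s + 1)]
    · rw [div_le_iff₀ this]; nlinarith [sq_nonneg (s - 1)]

/-- A Gronwall inequality for `‖x'‖ ≤ c (1 + ‖x‖)` with an integrable factor `c`. -/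
lemma log_one_add_norm_sq_le {E : Type*} [NormedAddCommGroup E] [InnerProductSpace ℝ E]
    {x : ℝ → E} {c : ℝ → ℝ} {a b : ℝ} (hab : a ≤ b) {k : NNReal}
    (hx : LipschitzOnWith k x (Icc a b)) (hc : IntervalIntegrable c volume a b)
    (hd : ∀ᵐ t, t ∈ Ioo a b → ∃ v, HasDerivAt x v t ∧ ‖v‖ ≤ c t * (1 + ‖x t‖)) :
    Real.log (1 + ‖x b‖ ^ 2) ≤ Real.log (1 + ‖x a‖ ^ 2) + 4 * ∫ t in a..b, c t := by
  set ψ : ℝ → ℝ := fun t => Real.log (1 + ‖x t‖ ^ 2) with hψ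
  have hlip : LipschitzOnWith k ψ (uIcc a b) := by
    rw [uIcc_of_le hab]
    refine LipschitzOnWith.of_dist_le_mul fun s hs t ht => ?_
    refine le_trans ?_ (hx.dist_le_mul s hs t ht)
    rw [Real.dist_eq, dist_eq_norm]
    exact (abs_log_one_add_sq_sub_le _ _).trans (abs_norm_sub_norm_le _ _)
  have hac := hlip.absolutelyContinuousOnInterval
  have hle : ∫ t in a..b, deriv ψ t ≤ ∫ t in a..b, 4 * c t := by
    refine intervalIntegral.integral_mono_ae_restrict hab hac.intervalIntegrable_deriv
      (hc.const_mul 4) ?_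
    rw [EventuallyLE, ← restrict_Ioo_eq_restrict_Icc, ae_restrict_iff' measurableSet_Ioo]
    filter_upwards [hd] with t ht htI
    obtain ⟨v, hv, hvc⟩ := ht htI
    have h1 : HasDerivAt ψ (2 * inner ℝ (x t) v / (1 + ‖x t‖ ^ 2)) t :=
      (hv.norm_sq.const_add 1).log (by positivity)
    rw [h1.deriv, div_le_iff₀ (by positivity)]
    have h2 : inner ℝ (x t) v ≤ ‖x t‖ * (c t * (1 + ‖x t‖)) :=
      (real_inner_le_norm _ _).trans (mul_le_mul_of_nonneg_left hvc (norm_nonneg _))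
    have hc0 : 0 ≤ c t :=
      nonneg_of_mul_nonneg_left ((norm_nonneg v).trans hvc) (by positivity)
    have h3 : 0 ≤ c t * ((‖x t‖ - 1) ^ 2 + 1) := by positivity
    nlinarith [norm_nonneg (x t)]
  rw [hac.integral_deriv_eq_sub, intervalIntegral.integral_const_mul] at hle
  simp only [hψ] at hle
  linarith

/-- A first exit argument: a bound that propagates from `[a, b)` to `b` holds on `[a, T)`. -/
lemma norm_lt_of_forall_norm_lt {E : Type*} [NormedAddCommGroup E] {x : ℝ → E}
    {a T R : ℝ} (hx : ContinuousOn x (Icc a T))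
    (h : ∀ b ∈ Ico a T, (∀ t ∈ Ico a b, ‖x t‖ < R) → ‖x b‖ < R) :
    ∀ t ∈ Ico a T, ‖x t‖ < R := by
  intro t ht
  by_contra! hR
  have hcomp : IsCompact (Icc a t ∩ (fun s => ‖x s‖) ⁻¹' Ici R) :=
    isCompact_Icc.of_isClosed_subset
      ((hx.norm.mono (Icc_subset_Icc_right ht.2.le)).preimage_isClosed_of_isClosed isClosed_Icc
        isClosed_Ici) inter_subset_left
  obtain ⟨b, ⟨hb, hbR⟩, hmin⟩ := hcomp.exists_isLeast ⟨t, ⟨ht.1, le_rfl⟩, hR⟩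
  refine absurd (h b ⟨hb.1, hb.2.trans_lt ht.2⟩ fun s hs => ?_) (not_lt.mpr hbR)
  by_contra! hsR
  exact absurd (hmin ⟨⟨hs.1, hs.2.le.trans hb.2⟩, hsR⟩) (not_le.mpr hs.2)

/-! ### Absolutely continuous solutions -/

lemma _root_.AbsolutelyContinuousOnInterval.prodMk {X Y : Type*} [PseudoMetricSpace X]
    [PseudoMetricSpace Y] {f : ℝ → X} {g : ℝ → Y} {a b : ℝ}
    (hf : AbsolutelyContinuousOnInterval f a b) (hg : AbsolutelyContinuousOnInterval g a b) :
    AbsolutelyContinuousOnInterval (fun t => (f t, g t)) a b := by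
  refine squeeze_zero (fun t => Finset.sum_nonneg fun i _ => dist_nonneg) (fun t => ?_)
    (by simpa using Tendsto.add hf hg)
  rw [← Finset.sum_add_distrib]
  refine Finset.sum_le_sum fun i _ => ?_
  rw [Prod.dist_eq]
  exact max_le (le_add_of_nonneg_right dist_nonneg) (le_add_of_nonneg_left dist_nonneg)

end Viability

open Viability in
theorem theorem4p3 (N : ℕ) (T : ℝ)
    (L : ℝ → EuclideanSpace ℝ (Fin N) → EuclideanSpace ℝ (Fin N) → EReal)
    (U : ℝ → EuclideanSpace ℝ (Fin N) → EReal)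
    (hL : Viability.IsLagrangian T L)
    (hU_proper : Viability.IsProper T U)
    (hU_lsc : LowerSemicontinuousOn
      (fun p : ℝ × EuclideanSpace ℝ (Fin N) => U p.1 p.2) (Icc 0 T ×ˢ univ))
    (hU_bdry : Viability.BoundaryCondition T L U) :
    ∀ t₀ ∈ Ico 0 T, ∀ x₀ ∈ Viability.effDom (U t₀),
      ∃ (x : ℝ → EuclideanSpace ℝ (Fin N)) (u : ℝ → ℝ),
        AbsolutelyContinuousOnInterval (fun t => (x t, u t)) t₀ T ∧
        x t₀ = x₀ ∧ (u t₀ : EReal) = U t₀ x₀ ∧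
        (∀ᵐ t ∂(volume.restrict (Icc t₀ T)),
          ∃ p ∈ Viability.Q L t (x t), HasDerivAt (fun s => (x s, u s)) p t) ∧
        ∀ t ∈ Icc t₀ T, U t (x t) ≤ (u t : EReal) := by
  intro t₀ ht₀ x₀ hx₀
  have hT : t₀ ≤ T := ht₀.2.le
  have hu₀ := coe_toReal_of_mem_effDom hx₀
  set u₀ := (U t₀ x₀).toReal with hu₀def
  have hw₀ : mkTriple t₀ x₀ u₀ ∈ epi T U := ⟨⟨ht₀.1, hT⟩, hu₀.symm.le⟩
  obtain ⟨c, hc0, hcint, Z, hZ, hcZ⟩ := hL.growth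
  have hcI : IntervalIntegrable c volume t₀ T := by
    rw [intervalIntegrable_iff_integrableOn_Icc_of_le hT]
    exact hcint.mono_set (Icc_subset_Icc_left ht₀.1)
  set I := ∫ t in t₀..T, c t with hI
  -- By Gronwall's inequality a solution never reaches a sphere of this radius.
  set R := (1 + ‖x₀‖ ^ 2) * Real.exp (4 * I) with hRdef
  have hI0 : 0 ≤ I := intervalIntegral.integral_nonneg hT
    fun t ht => hc0 t ⟨ht₀.1.trans ht.1, ht.2⟩
  have hR1 : 1 ≤ R := one_le_mul_of_one_le_of_one_le (by nlinarith [sq_nonneg ‖x₀‖])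
    (Real.one_le_exp (by linarith))
  have hRlog : Real.log (1 + ‖x₀‖ ^ 2) + 4 * I < Real.log (1 + R ^ 2) := by
    have h1 : Real.log R = Real.log (1 + ‖x₀‖ ^ 2) + 4 * I := by
      rw [hRdef, Real.log_mul (by positivity) (Real.exp_ne_zero _), Real.log_exp]
    rw [← h1]
    exact Real.log_lt_log (by linarith) (by nlinarith)
  obtain ⟨C, K, z, hC, hz⟩ := exists_isLimitCurve hL hU_proper hU_lsc hU_bdry
    (ht₀.1.trans hT) hw₀ R
  set x : ℝ → EuclideanSpace ℝ (Fin N) := fun t => (z t).snd.fst with hx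
  set g : ℝ → ℝ := fun t => K * t - (z t).snd.snd with hg
  have hlip : LipschitzOnWith C.toNNReal x (Icc t₀ T) := hz.lipschitzOnWith hC
  have hmono : MonotoneOn g (Icc t₀ T) := hz.monotoneOn
  have hxt₀ : x t₀ = x₀ := congrArg (fun w : Triple N => w.snd.fst) hz.start
  have hzut₀ : (z t₀).snd.snd = u₀ := congrArg (fun w : Triple N => w.snd.snd) hz.start
  set ν : ℝ → ℝ := fun t => K - deriv g t with hν
  -- The curve is differentiable almost everywhere, with derivative `(deriv x, ν)`.
  have hdiff : ∀ᵐ t, t ∈ Ioo t₀ T →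
      HasDerivAt x (deriv x t) t ∧ HasDerivAt (fun s => (z s).snd.snd) (ν t) t := by
    filter_upwards [hlip.ae_differentiableWithinAt_of_mem_real,
      hmono.ae_differentiableWithinAt_of_mem] with t h1 h2 ht
    have hnhds : Icc t₀ T ∈ 𝓝 t := Icc_mem_nhds ht.1 ht.2
    have ht' := Ioo_subset_Icc_self ht
    refine ⟨((h1 ht').differentiableAt hnhds).hasDerivAt, ?_⟩
    have h3 := ((h2 ht').differentiableAt hnhds).hasDerivAt
    have h4 := ((hasDerivAt_id t).const_mul K).sub h3
    convert! h4 using 1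
    · funext s; simp [hg]
    · simp [hν]
  have hsol : ∀ᵐ t, t ∈ Ioo t₀ T → ‖x t‖ < R →
      L t (x t) (deriv x t) ≤ ((-ν t : ℝ) : EReal) := by
    filter_upwards [hdiff] with t ht htI hR
    exact hz.le_of_hasDerivAt hL ht₀.1 (Ioo_subset_Ico_self htI) hR (ht htI).1 (ht htI).2
  have hxR : ∀ t ∈ Ico t₀ T, ‖x t‖ < R := by
    refine norm_lt_of_forall_norm_lt hlip.continuousOn fun b hb hlt => ?_
    have hsub : Icc t₀ b ⊆ Icc t₀ T := Icc_subset_Icc_right hb.2.le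
    have hgr := log_one_add_norm_sq_le hb.1 (hlip.mono hsub)
      (hcI.mono_set (by rw [uIcc_of_le hb.1, uIcc_of_le hT]; exact hsub)) (by
        filter_upwards [hdiff, hsol, measure_eq_zero_iff_ae_notMem.mp hZ] with t h1 h2 h3 ht
        have htT : t ∈ Ioo t₀ T := ⟨ht.1, ht.2.trans hb.2⟩
        refine ⟨_, (h1 htT).1, ?_⟩
        by_contra! hlt'
        have htop := hcZ t ⟨⟨ht₀.1.trans ht.1.le, htT.2.le⟩, h3⟩ (x t) (deriv x t) hlt'
        have hle := h2 htT (hlt t ⟨ht.1.le, ht.2⟩)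
        rw [htop] at hle
        exact EReal.coe_ne_top _ (top_le_iff.mp hle))
    have hIb : ∫ t in t₀..b, c t ≤ I := by
      refine intervalIntegral.integral_mono_interval le_rfl hb.1 hb.2.le ?_ hcI
      rw [EventuallyLE, ae_restrict_iff' measurableSet_Ioc]
      exact Eventually.of_forall fun t ht => hc0 t ⟨ht₀.1.trans ht.1.le, ht.2⟩
    rw [hxt₀] at hgr
    by_contra! hRb
    have : Real.log (1 + R ^ 2) ≤ Real.log (1 + ‖x b‖ ^ 2) := by gcongr
    linarith
  have hgI : IntervalIntegrable (deriv g) volume t₀ T :=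
    MonotoneOn.intervalIntegrable_deriv (by rwa [uIcc_of_le hT])
  have hνI : IntervalIntegrable ν volume t₀ T := intervalIntegrable_const.sub hgI
  -- The integral of the derivative of `z.snd.snd` discards its singular and jump parts. These
  -- are decreasing, so that the result lies above the limit curve.
  set u : ℝ → ℝ := fun t => u₀ + ∫ s in t₀..t, ν s with hu
  have huac : AbsolutelyContinuousOnInterval u t₀ T := by
    have hconst : AbsolutelyContinuousOnInterval (fun _ : ℝ => u₀) t₀ T :=
      (LipschitzOnWith.of_dist_le_mul (K := 0) (by simp)).absolutelyContinuousOnInterval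
    exact hconst.add
      (hνI.absolutelyContinuousOnInterval_intervalIntegral left_mem_uIcc)
  have hzu : ∀ t ∈ Icc t₀ T, (z t).snd.snd ≤ u t := by
    intro t ht
    have hsub : uIcc t₀ t ⊆ Icc t₀ T := by
      rw [uIcc_of_le ht.1]; exact Icc_subset_Icc_right ht.2
    have h1 := (hmono.mono hsub).intervalIntegral_deriv_mem_uIcc
    rw [uIcc_of_le (sub_nonneg.mpr (hmono ⟨le_rfl, hT⟩ ht ht.1))] at h1
    have h2 : ∫ s in t₀..t, ν s = K * (t - t₀) - ∫ s in t₀..t, deriv g s := by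
      rw [hν, intervalIntegral.integral_sub intervalIntegrable_const
        (hgI.mono_set (by rw [uIcc_of_le hT]; exact hsub)), intervalIntegral.integral_const,
        smul_eq_mul, mul_comm]
    have h3 := h1.2
    simp only [hg, hzut₀] at h3
    simp only [hu]
    rw [h2]
    linarith
  have hxac : AbsolutelyContinuousOnInterval x t₀ T :=
    LipschitzOnWith.absolutelyContinuousOnInterval (by rwa [uIcc_of_le hT])
  have hmem : ∀ t ∈ Ico t₀ T, U t (x t) ≤ (u t : EReal) := by
    intro t ht
    have ht' := Ico_subset_Icc_self ht
    have h1 := (hz.mem_epi t ht').2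
    rw [hz.fst_eq t ht (hxR t ht)] at h1
    exact h1.trans (EReal.coe_le_coe_iff.mpr (hzu t ht'))
  refine ⟨x, u, hxac.prodMk huac, hxt₀, ?_, ?_, ?_⟩
  · simpa [hu] using hu₀
  · rw [← restrict_Ioo_eq_restrict_Icc, ae_restrict_iff' measurableSet_Ioo]
    filter_upwards [hdiff, hsol, hνI.ae_hasDerivAt_integral] with t h1 h2 h3 ht
    have htI : t ∈ uIcc t₀ T := by rw [uIcc_of_le hT]; exact Ioo_subset_Icc_self ht
    exact ⟨(deriv x t, ν t), h2 ht (hxR t (Ioo_subset_Ico_self ht)),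
      (h1 ht).1.prodMk ((h3 htI t₀ left_mem_uIcc).const_add u₀)⟩
  · intro t ht
    rcases ht.2.lt_or_eq with h | rfl
    · exact hmem t ⟨ht.1, h⟩
    -- At the final time the inequality follows from the closedness of the epigraph.
    have htI : t ∈ uIcc t₀ t := right_mem_uIcc
    have hsub : Ico t₀ t ⊆ uIcc t₀ t := by rw [uIcc_of_le hT]; exact Ico_subset_Icc_self
    have hxlim := (hxac.continuousOn t htI).mono hsub
    have hulim := (huac.continuousOn t htI).mono hsub
    have : (𝓝[Ico t₀ t] t).NeBot := by
      rw [← mem_closure_iff_nhdsWithin_neBot, closure_Ico ht₀.2.ne]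
      exact ⟨hT, le_rfl⟩
    have hcl := (lowerSemicontinuousOn_iff_isClosed_epigraph
      (isClosed_Icc.prod isClosed_univ)).mp hU_lsc
    have hid : Tendsto (fun s : ℝ => s) (𝓝[Ico t₀ t] t) (𝓝 t) := nhdsWithin_le_nhds
    have hfin := hcl.mem_of_tendsto ((hid.prodMk_nhds hxlim).prodMk_nhds
      ((continuous_coe_real_ereal.tendsto _).comp hulim)) (by
        filter_upwards [self_mem_nhdsWithin] with s hs
        exact ⟨⟨⟨ht₀.1.trans hs.1, hs.2.le⟩, mem_univ _⟩, hmem s hs⟩)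
    exact hfin.2
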